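/- Let $p$ be a prime, let $k$ be an algebraically closed field of characteristic $p$, and let $K_0 = \mathrm{Frac}(W(k))$ be the fraction field of the ring of Witt vectors of $k$. Let $\ell \ge 1$ be an integer, let $K_\ell = K_0(\zeta_{p^\ell})$ with $\zeta_{p^\ell}$ a primitive $p^\ell$-th root of unity, and let $M/K_\ell$ be a finite extension such that $M/K_0$ is Galois. For $K \in \{K_0, K_\ell\}$ let $G = \mathrm{Gal}(M/K)$, let $v_M$ be the normalized discrete valuation of $M$ (a uniformizer has valuation $1$) and $\mathcal O_M$ its valuation ring. For real $i \ge 0$ let $G_i = \{g \in G : v_M(gx - x) \ge i+1 \text{ for all } x \in \mathcal O_M\}$ be the ramification groups in the lower numbering, let $\phi_{M/K}(u) = \int_0^u \frac{dt}{[G_0:G_t]}$ for $u \ge 0$, let $\psi_{M/K}$ be the inverse of $\phi_{M/K}:[0,\infty)\to[0,\infty)$, and let $G^i = G_{\psi_{M/K}(i)}$ be the ramification groups in the upper numbering. The conductor of $M/K$ is $h_{M/K} = \sup\{i \in [0,\infty) : G^i \ne \{\mathrm{id}\}\}$, where the supremum of the empty set is $0$. Then $$h_{M/K_0} = \max\left(\ell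 - 1,\ \ell - \frac{p}{p-1} + \frac{1}{(p-1)p^{\ell-1}}\left(h_{M/K_\ell} + 1\right)\right).$$ -/

import Mathlib

open scoped WithZero

namespace LocalRamification

section RingOfIntegers

/-! Throughout, `A` is a complete discrete valuation ring with fraction field `K₀`, and `M/K₀` is
a finite separable extension. The integral closure of `A` in `M` is the valuation ring of `M`. -/

theorem isAdicComplete_of_finite (A B : Type*) [CommRing A] [IsNoetherianRing A] [CommRing B]
    [Algebra A B] [Module.Finite A B] [IsLocalRing A]
    [IsAdicComplete (IsLocalRing.maximalIdeal A) A] :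
    IsAdicComplete ((IsLocalRing.maximalIdeal A).map (algebraMap A B)) B := by
  rw [IsAdicComplete.map_algebraMap_iff]
  have hp : IsPrecomplete (IsLocalRing.maximalIdeal A) B := by
    rw [← AdicCompletion.of_surjective_iff]
    intro y
    obtain ⟨t, rfl⟩ := AdicCompletion.ofTensorProduct_surjective_of_finite
      (IsLocalRing.maximalIdeal A) B y
    induction t with
    | zero => exact ⟨0, by simp⟩
    | add x y hx hy =>
      obtain ⟨a, ha⟩ := hx
      obtain ⟨b, hb⟩ := hy
      exact ⟨a + b, by rw [map_add, map_add, ha, hb]⟩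
    | tmul r x =>
      obtain ⟨a, rfl⟩ := AdicCompletion.of_surjective (IsLocalRing.maximalIdeal A) A r
      refine ⟨a • x, ?_⟩
      rw [AdicCompletion.ofTensorProduct_tmul, map_smul]
      have : AdicCompletion.of (IsLocalRing.maximalIdeal A) A a
          = algebraMap A (AdicCompletion (IsLocalRing.maximalIdeal A) A) a := rfl
      rw [this, algebraMap_smul]
  exact { toIsPrecomplete := hp, toIsHausdorff := inferInstance }

/-- A Dedekind domain that is adically complete at a nonzero ideal contained in every maximal
ideal is local. -/
theorem isLocalRing_of_dedekind (B : Type*) [CommRing B] [IsDedekindDomain B] (I : Ideal B)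
    (hI : I ≠ ⊥) (hI' : I ≠ ⊤) [IsAdicComplete I B] : IsLocalRing B := by
  obtain ⟨P, hP, hIP⟩ := Ideal.exists_le_maximal I hI'
  have hP0 : P ≠ ⊥ := fun h => hI (le_bot_iff.mp (h ▸ hIP))
  have hPprime : Prime P := Ideal.prime_of_isPrime hP0 hP.isPrime
  have hfin : FiniteMultiplicity P I :=
    FiniteMultiplicity.of_not_isUnit hPprime.not_isUnit hI
  obtain ⟨J, hJ, hPJ⟩ := hfin.exists_eq_pow_mul_and_not_dvd
  set n := multiplicity P I with hn
  have hn0 : n ≠ 0 := by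
    intro h0
    rw [h0, pow_zero, one_mul] at hJ
    exact hPJ (hJ ▸ Ideal.dvd_iff_le.mpr hIP)
  have hcop : IsCoprime (P ^ n) J := by
    apply IsCoprime.pow_left
    rw [Ideal.isCoprime_iff_sup_eq]
    by_contra h
    have h1 := hP.eq_of_le h le_sup_left
    exact hPJ (Ideal.dvd_iff_le.mpr (h1 ▸ le_sup_right))
  obtain ⟨e, he, f, hf, hef⟩ := Ideal.isCoprime_iff_exists.mp hcop
  have hmul : e * f ∈ I := hJ ▸ Ideal.mul_mem_mul he hf
  have hfe : f = 1 - e := by rw [← hef]; ring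
  obtain ⟨a, ha, hae⟩ := HenselianRing.is_henselian (I := I)
    (Polynomial.X ^ 2 - Polynomial.X : Polynomial B)
    (by monicity!) e
    (by
      have : Polynomial.eval e (Polynomial.X ^ 2 - Polynomial.X : Polynomial B) = -(e * f) := by
        simp [hfe]; ring
      rw [this]; exact I.neg_mem hmul)
    (by
      refine IsUnit.of_mul_eq_one (Ideal.Quotient.mk I (2 * e - 1)) ?_
      rw [← map_mul, ← map_one (Ideal.Quotient.mk I), Ideal.Quotient.eq]
      have : Polynomial.eval e (Polynomial.derivative
          (Polynomial.X ^ 2 - Polynomial.X : Polynomial B)) * (2 * e - 1) - 1 = -4 * (e * f) := by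
        simp [hfe]; ring
      rw [this]; exact I.mul_mem_left _ hmul)
  have hIPn : I ≤ P ^ n := hJ.le.trans Ideal.mul_le_left
  have hIJ : I ≤ J := hJ.le.trans Ideal.mul_le_right
  have hPn : P ^ n ≤ P := Ideal.pow_le_self hn0
  have hroot : a * (a - 1) = 0 := by
    have : a ^ 2 - a = 0 := by simpa using ha
    rw [← this]; ring
  have hJtop : J = ⊤ := by
    rcases mul_eq_zero.mp hroot with h | h
    · have h1 : e ∈ J := by
        have := J.neg_mem (hIJ hae)
        simpa [h] using this
      rw [Ideal.eq_top_iff_one, ← hef]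
      exact J.add_mem h1 hf
    · exfalso
      have h1 : f ∈ P := by
        have := hPn (hIPn hae)
        rwa [sub_eq_zero.mp h, ← hfe] at this
      exact hP.ne_top ((Ideal.eq_top_iff_one _).mpr (hef ▸ P.add_mem (hPn he) h1))
  rw [hJtop, Ideal.mul_top] at hJ
  refine IsLocalRing.of_unique_max_ideal ⟨P, hP, fun Q hQ => ?_⟩
  have hIQ : I ≤ Q := by
    refine (HenselianRing.jac (I := I)).trans ?_
    exact sInf_le ⟨bot_le, hQ⟩
  have : P ≤ Q := hQ.isPrime.le_of_pow_le (hJ ▸ hIQ)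
  exact (hP.eq_of_le hQ.ne_top this).symm

/-- The valuation ring of a finite separable extension of a complete discretely valued field is
again a discrete valuation ring. -/
theorem isDiscreteValuationRing_integralClosure (A K₀ M : Type*)
    [CommRing A] [IsDomain A] [IsDiscreteValuationRing A]
    [IsAdicComplete (IsLocalRing.maximalIdeal A) A]
    [Field K₀] [Algebra A K₀] [IsFractionRing A K₀]
    [Field M] [Algebra K₀ M] [Algebra A M] [IsScalarTower A K₀ M]
    [FiniteDimensional K₀ M] [Algebra.IsSeparable K₀ M] :
    IsDiscreteValuationRing (integralClosure A M) := by
  have := IsIntegralClosure.finite A K₀ M (integralClosure A M)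
  have := integralClosure.isDedekindDomain A K₀ M
  have hinj : Function.Injective (algebraMap A (integralClosure A M)) := by
    have : Function.Injective (algebraMap A M) := by
      rw [IsScalarTower.algebraMap_eq A K₀ M]
      exact (algebraMap K₀ M).injective.comp (IsFractionRing.injective A K₀)
    rw [IsScalarTower.algebraMap_eq A (integralClosure A M) M, RingHom.coe_comp] at this
    exact Function.Injective.of_comp this
  have := isAdicComplete_of_finite A (integralClosure A M)
  have hm : (IsLocalRing.maximalIdeal A).map (algebraMap A (integralClosure A M)) ≠ ⊥ := by
    rw [Ne, Ideal.map_eq_bot_iff_of_injective hinj]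
    exact IsDiscreteValuationRing.not_a_field A
  have hm' : (IsLocalRing.maximalIdeal A).map (algebraMap A (integralClosure A M)) ≠ ⊤ := by
    intro h
    obtain ⟨Q, hQ, hQ'⟩ := Ideal.exists_ideal_over_maximal_of_isIntegral
      (S := integralClosure A M) (IsLocalRing.maximalIdeal A)
      (by rw [(RingHom.injective_iff_ker_eq_bot _).mp hinj]; exact bot_le)
    exact hQ.ne_top (top_le_iff.mp (h ▸ Ideal.map_le_iff_le_comap.mpr hQ'.ge))
  have := isLocalRing_of_dedekind _ _ hm hm'
  have hf : ¬ IsField (integralClosure A M) := fun h =>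
    IsDiscreteValuationRing.not_isField A (isField_of_isIntegral_of_isField hinj h)
  have htfae : IsDiscreteValuationRing (integralClosure A M) ↔
      IsDedekindDomain (integralClosure A M) :=
    (IsDiscreteValuationRing.TFAE (integralClosure A M) hf).out 0 2
  exact htfae.mpr inferInstance

/-- The normalized discrete valuation of `M`, written multiplicatively: `v x = exp (-n)` means that
`v_M(x) = n`, so that a uniformizer of `M` has valuation `exp (-1)`, and `v 0 = 0`. -/
noncomputable def normalizedValuation (A K₀ M : Type*)
    [CommRing A] [IsDomain A] [IsDiscreteValuationRing A]
    [IsAdicComplete (IsLocalRing.maximalIdeal A) A]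
    [Field K₀] [Algebra A K₀] [IsFractionRing A K₀]
    [Field M] [Algebra K₀ M] [Algebra A M] [IsScalarTower A K₀ M]
    [FiniteDimensional K₀ M] [Algebra.IsSeparable K₀ M] :
    Valuation M ℤᵐ⁰ :=
  haveI := isDiscreteValuationRing_integralClosure A K₀ M
  haveI := integralClosure.isFractionRing_of_finite_extension (A := A) K₀ M
  (IsDiscreteValuationRing.maximalIdeal (integralClosure A M)).valuation M

end RingOfIntegers

section Ramification

/-! Here `K₀ ⊆ K ⊆ M`, and `M/K` is Galois with group `G = M ≃ₐ[K] M`. -/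

variable (A K₀ K M : Type*)
  [CommRing A] [IsDomain A] [IsDiscreteValuationRing A]
  [IsAdicComplete (IsLocalRing.maximalIdeal A) A]
  [Field K₀] [Algebra A K₀] [IsFractionRing A K₀]
  [Field M] [Algebra K₀ M] [Algebra A M] [IsScalarTower A K₀ M]
  [FiniteDimensional K₀ M] [Algebra.IsSeparable K₀ M]
  [Field K] [Algebra K₀ K] [Algebra K M] [IsScalarTower K₀ K M]

/-- The lower numbering: `G_i` consists of the `g` with `v_M(g x - x) ≥ i + 1` for all `x` in the
valuation ring of `M`. As `v_M` is integer-valued, `i + 1` may be replaced by `⌈i⌉ + 1`. -/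
noncomputable def lowerRamificationGroup (i : ℝ) : Subgroup (M ≃ₐ[K] M) where
  carrier := {g | ∀ x ∈ integralClosure A M,
    normalizedValuation A K₀ M (g x - x) ≤ WithZero.exp (-(⌈i⌉ + 1))}
  one_mem' := by
    intro x _
    simp
  mul_mem' := by
    intro g h hg hh x hx
    have hx' : h x ∈ integralClosure A M :=
      IsIntegral.map ((h.restrictScalars K₀).restrictScalars A) hx
    have : (g * h) x - x = (g (h x) - h x) + (h x - x) := by
      simp
    rw [this]
    exact Valuation.map_add_le _ (hg _ hx') (hh _ hx)
  inv_mem' := by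
    intro g hg x hx
    have hx' : g⁻¹ x ∈ integralClosure A M :=
      IsIntegral.map ((g⁻¹.restrictScalars K₀).restrictScalars A) hx
    have h1 : g (g⁻¹ x) = x := by
      rw [← AlgEquiv.mul_apply, mul_inv_cancel, AlgEquiv.one_apply]
    have := hg _ hx'
    rwa [h1, Valuation.map_sub_swap] at this

/-- The Herbrand function `φ_{M/K}(u) = ∫₀ᵘ dt / [G_0 : G_t]`. -/
noncomputable def herbrandPhi (u : ℝ) : ℝ :=
  ∫ t in (0 : ℝ)..u, (((lowerRamificationGroup A K₀ K M t).relIndex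
    (lowerRamificationGroup A K₀ K M 0) : ℕ) : ℝ)⁻¹

/-- The function `ψ_{M/K}`, inverse to `φ_{M/K} : [0, ∞) → [0, ∞)`. -/
noncomputable def herbrandPsi (v : ℝ) : ℝ :=
  Function.invFunOn (herbrandPhi A K₀ K M) (Set.Ici 0) v

/-- The upper numbering: `G^i = G_{ψ(i)}`. -/
noncomputable def upperRamificationGroup (i : ℝ) : Subgroup (M ≃ₐ[K] M) :=
  lowerRamificationGroup A K₀ K M (herbrandPsi A K₀ K M i)

/-- The conductor `h_{M/K}`, the supremum in `[0, ∞)` of the indices `i` with `G^i ≠ 1`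
(so it is `0` if there are none, that is, if `M = K`). -/
noncomputable def conductor : ℝ :=
  sSup {i : ℝ | 0 ≤ i ∧ upperRamificationGroup A K₀ K M i ≠ ⊥}

end Ramification

/-- The Witt vectors over a perfect field of characteristic `p` form a complete discrete valuation
ring. -/
instance isAdicComplete_wittVector (p : ℕ) [Fact p.Prime] (k : Type*) [Field k] [CharP k p]
    [PerfectRing k p] : IsAdicComplete (IsLocalRing.maximalIdeal (WittVector p k)) (WittVector p k) := by
  rw [(IsDiscreteValuationRing.irreducible_iff_uniformizer _).mp (WittVector.irreducible p)]
  infer_instance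

end LocalRamification

namespace LocalRamification

/-! ### Totally ramified extensions of discrete valuation rings -/

section TotallyRamified

open IsLocalRing

variable {A B : Type*} [CommRing A] [IsDomain A] [IsDiscreteValuationRing A]
  [CommRing B] [IsDomain B] [IsDiscreteValuationRing B] [Algebra A B] [Module.Finite A B]
  [FaithfulSMul A B] [IsAlgClosed (ResidueField A)]

/-! Write `ℓ = n + 1`, `L = K₀(ζ)`, `G = Gal(M/K₀)`, `H = Gal(M/L)`. As the residue field is
algebraically closed, everything is totally ramified, so a uniformizer `x` generates the ring of
integers of `M`, and `i(g) = v_M(x - g x)` determines the ramification groups of both `G` and `H`.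
The Herbrand function becomes a finite sum in the `i(g)`. Evaluated at the last lower jump `m` it
gives the conductor `(m + 1 + ∑_{g ≠ 1} i(g)) / |G| - 1` (`conductor_eq`).

By Herbrand's lemma (`associated_prod_sub_smul`) the sum of `i` over a nontrivial coset `gH` is
`v_M(ζ - g ζ)`. Let `e = v_M(η - 1) = |G|/(p - 1)` for a primitive `p`-th root of unity `η`. Then
each such sum is at most `e`, with equality for some coset if `n ≥ 1`. Together they give the
different of `L/K₀`, namely `R = (n + 1)|G| - e` (`exists_sum_displacement`).

With `T = ∑_{h ≠ 1} i(h)` over `H`, the inequality `i(gh) ≥ min(i(g), i(h))` then yields `m_G + 1 +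
T = max(e, m_H + 1 + T)` (`lastJump_add_sum_eq_max`). Adding `R`, dividing by `|G|` and subtracting
1 turns the term `e` into `ℓ - 1` and the other term into the expression in the conductor over `L`.
-/

theorem residueField_algebraMap_bijective :
    Function.Bijective (algebraMap (ResidueField A) (ResidueField B)) :=
  IsAlgClosed.algebraMap_bijective_of_isIntegral

theorem exists_sub_algebraMap_mem_maximalIdeal (b : B) :
    ∃ a : A, b - algebraMap A B a ∈ maximalIdeal B := by
  obtain ⟨c, hc⟩ := (residueField_algebraMap_bijective (A := A) (B := B)).2 (residue B b)
  obtain ⟨a, rfl⟩ := residue_surjective c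
  refine ⟨a, ?_⟩
  rw [← residue_eq_zero_iff, map_sub, ← hc, ResidueField.algebraMap_residue, sub_self]

/-- A finite extension of discrete valuation rings with trivial residue field extension is
generated by any uniformizer. -/
theorem adjoin_uniformizer_eq_top {π : B} (hπ : Irreducible π) :
    Algebra.adjoin A {π} = ⊤ := by
  have hπmem : π ∈ Algebra.adjoin A {π} := Algebra.self_mem_adjoin_singleton A π
  have key : ∀ n : ℕ, ∀ b : B, ∃ a ∈ Algebra.adjoin A {π}, ∃ c : B, b = a + π ^ n * c := by
    intro n
    induction n with
    | zero => exact fun b => ⟨0, zero_mem _, b, by simp⟩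
    | succ n ih =>
      intro b
      obtain ⟨a, ha, c, rfl⟩ := ih b
      obtain ⟨a', ha'⟩ := exists_sub_algebraMap_mem_maximalIdeal (A := A) c
      rw [hπ.maximalIdeal_eq, Ideal.mem_span_singleton] at ha'
      obtain ⟨d, hd⟩ := ha'
      refine ⟨a + π ^ n * algebraMap A B a', add_mem ha (mul_mem (pow_mem hπmem n)
        (Subalgebra.algebraMap_mem _ a')), d, ?_⟩
      rw [eq_add_of_sub_eq hd]; ring
  -- Taking the approximation to order `e`, where `ϖ` is associated to `π ^ e`, gives `B = A[π] +
  -- ϖB`, and Nakayama's lemma finishes.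
  obtain ⟨ϖ, hϖ⟩ := IsDiscreteValuationRing.exists_irreducible A
  have hϖ0 : algebraMap A B ϖ ≠ 0 := by
    simpa using hϖ.ne_zero
  obtain ⟨e, he⟩ := IsDiscreteValuationRing.associated_pow_irreducible hϖ0 hπ
  obtain ⟨d, hd⟩ := he.dvd
  have : (⊤ : Submodule A B) ≤ Subalgebra.toSubmodule (Algebra.adjoin A {π}) := by
    refine Submodule.le_of_le_smul_of_le_jacobson_bot (I := maximalIdeal A) Module.Finite.fg_top
      (maximalIdeal_le_jacobson _) ?_
    intro b _
    obtain ⟨a, ha, c, rfl⟩ := key e b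
    refine Submodule.add_mem_sup ha ?_
    rw [hd, mul_assoc, ← Algebra.smul_def]
    exact Submodule.smul_mem_smul ((mem_maximalIdeal _).mpr hϖ.not_isUnit) trivial
  exact top_le_iff.mp fun b hb => this hb

/-- The ramification index of a finite extension of discrete valuation rings with algebraically
closed residue field is the degree. -/
theorem addVal_algebraMap_uniformizer {ϖ : A} (hϖ : Irreducible ϖ) :
    IsDiscreteValuationRing.addVal B (algebraMap A B ϖ) = Module.finrank A B := by
  have hϖ0 : algebraMap A B ϖ ≠ 0 := by
    simpa using hϖ.ne_zero
  obtain ⟨π, hπ⟩ := IsDiscreteValuationRing.exists_irreducible B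
  obtain ⟨e, u, hu⟩ := IsDiscreteValuationRing.eq_unit_mul_pow_irreducible hϖ0 hπ
  rw [hu, IsDiscreteValuationRing.addVal_def' u hπ]
  have hpB : (maximalIdeal A).map (algebraMap A B) = maximalIdeal B ^ e := by
    rw [hϖ.maximalIdeal_eq, hπ.maximalIdeal_eq, Ideal.map_span, Set.image_singleton, hu,
      Ideal.span_singleton_pow, Ideal.span_singleton_mul_left_unit u.isUnit]
  have hlies : (maximalIdeal B).LiesOver (maximalIdeal A) := inferInstance
  have hp0 : maximalIdeal A ≠ ⊥ := IsDiscreteValuationRing.not_a_field A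
  have huniq : ∀ q : (maximalIdeal A).primesOver B, q = ⟨maximalIdeal B, inferInstance, hlies⟩ := by
    rintro ⟨q, hq, hqo⟩
    have : q.IsMaximal := Ideal.IsMaximal.of_liesOver_isMaximal q (maximalIdeal A)
    exact Subtype.ext (IsLocalRing.eq_maximalIdeal this)
  let _ : Fintype ((maximalIdeal A).primesOver B) :=
    ⟨{⟨maximalIdeal B, inferInstance, hlies⟩}, fun q => by simp [huniq q]⟩
  -- Only one prime lies above and its inertia degree is 1, so `∑ e f = [B : A]` reduces to `e = [B
  -- : A]`.
  have hsum := Ideal.sum_ramification_inertia_eq_finrank (maximalIdeal A) B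
  rw [Finset.sum_eq_single_of_mem ⟨maximalIdeal B, inferInstance, hlies⟩ (Finset.mem_univ _)
    (fun b _ hb => absurd (huniq b) hb)] at hsum
  have hf : (maximalIdeal B).inertiaDeg A = 1 := by
    rw [Ideal.inertiaDeg_eq_of_isMaximal (maximalIdeal A)]
    change Module.finrank (ResidueField A) (ResidueField B) = 1
    exact Module.finrank_of_bijective_algebraMap residueField_algebraMap_bijective
  have he : (maximalIdeal B).ramificationIdx A = e := by
    rw [← Ideal.ramificationIdx'_eq_ramificationIdx (maximalIdeal A) _ hp0]
    refine Ideal.ramificationIdx'_spec hpB.le ?_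
    rw [hpB]
    intro h
    exact absurd h (not_le_of_gt (Ideal.pow_succ_lt_pow (IsDiscreteValuationRing.not_a_field B)  _))
  rw [← hsum, hf, he, mul_one]

end TotallyRamified

/-! ### The Herbrand function and the conductor in terms of displacements -/

section Conductor

theorem intervalIntegrable_ite_add_one_le (n : ℕ) (a b : ℝ) :
    IntervalIntegrable (fun t : ℝ => if t + 1 ≤ n then (1 : ℝ) else 0) MeasureTheory.volume a b := by
  apply Antitone.intervalIntegrable
  intro s t hst
  dsimp only
  split_ifs <;> linarith

theorem integral_ite_add_one_le {n : ℕ} (hn : 1 ≤ n) {u : ℝ} (hu : 0 ≤ u) :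
    ∫ t in (0 : ℝ)..u, (if t + 1 ≤ n then (1 : ℝ) else 0) = min ((n : ℝ) - 1) u := by
  have hn' : (1 : ℝ) ≤ n := by exact_mod_cast hn
  rcases le_total ((n : ℝ) - 1) u with h | h
  · have heq : (fun t : ℝ => if t + 1 ≤ (n : ℝ) then (1 : ℝ) else 0) =
        Set.indicator {t | t ≤ (n : ℝ) - 1} (fun _ => 1) := by
      ext t
      simp only [Set.indicator_apply, Set.mem_ofPred_eq, le_sub_iff_add_le]
    rw [heq, intervalIntegral.integral_indicator ⟨by linarith, h⟩, min_eq_left h]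
    simp
  · rw [min_eq_right h, intervalIntegral.integral_congr (g := fun _ => (1 : ℝ))]
    · simp
    · intro t ht
      rw [Set.uIcc_of_le hu] at ht
      have : t + 1 ≤ n := by linarith [ht.2]
      simp [this]

variable (A K₀ K M : Type*)
  [CommRing A] [IsDomain A] [IsDiscreteValuationRing A]
  [IsAdicComplete (IsLocalRing.maximalIdeal A) A]
  [Field K₀] [Algebra A K₀] [IsFractionRing A K₀]
  [Field M] [Algebra K₀ M] [Algebra A M] [IsScalarTower A K₀ M]
  [FiniteDimensional K₀ M] [Algebra.IsSeparable K₀ M]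
  [Field K] [Algebra K₀ K] [Algebra K M] [IsScalarTower K₀ K M]

section Formula

variable {A K₀ K M}
variable [Fintype (M ≃ₐ[K] M)] [DecidableEq (M ≃ₐ[K] M)] {i : (M ≃ₐ[K] M) → ℕ}
  (hi : ∀ g ≠ 1, 1 ≤ i g)
  (hmem : ∀ t : ℝ, 0 ≤ t → ∀ g, g ∈ lowerRamificationGroup A K₀ K M t ↔ g = 1 ∨ t + 1 ≤ i g)

include hmem in
theorem card_lowerRamificationGroup {t : ℝ} (ht : 0 ≤ t) :
    (Nat.card (lowerRamificationGroup A K₀ K M t) : ℝ) =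
      1 + ∑ g ∈ Finset.univ.erase (1 : M ≃ₐ[K] M), if t + 1 ≤ i g then (1 : ℝ) else 0 := by
  classical
  rw [Finset.sum_boole, Nat.card_eq_fintype_card, Fintype.card_subtype]
  have : (Finset.univ.filter fun g => g ∈ lowerRamificationGroup A K₀ K M t) =
      insert 1 ((Finset.univ.erase (1 : M ≃ₐ[K] M)).filter fun g => t + 1 ≤ i g) := by
    ext g
    by_cases h : g = 1 <;> simp [hmem t ht, h]
  rw [this, Finset.card_insert_of_notMem (by simp)]
  push_cast
  ring

-- The integrand is `|G_t| / |G|`, because `G_0 = G`. Counting `G_t` as a sum of indicators over `g`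
-- and integrating each one gives a term `min (i g - 1) u`; the identity contributes `u`.
include hi hmem in
theorem herbrandPhi_eq {u : ℝ} (hu : 0 ≤ u) :
    herbrandPhi A K₀ K M u =
      (u + ∑ g ∈ Finset.univ.erase (1 : M ≃ₐ[K] M), min ((i g : ℝ) - 1) u) /
        Fintype.card (M ≃ₐ[K] M) := by
  have h0 : lowerRamificationGroup A K₀ K M 0 = ⊤ := by
    rw [eq_top_iff]
    intro g _
    rw [hmem 0 le_rfl]
    by_cases h : g = 1
    · exact Or.inl h
    · right
      have := hi g h
      rw [zero_add]
      exact_mod_cast this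
  have hcongr : Set.EqOn (fun t : ℝ => (((lowerRamificationGroup A K₀ K M t).relIndex
      (lowerRamificationGroup A K₀ K M 0) : ℕ) : ℝ)⁻¹)
      (fun t => (1 + ∑ g ∈ Finset.univ.erase (1 : M ≃ₐ[K] M),
        if t + 1 ≤ i g then (1 : ℝ) else 0) / Fintype.card (M ≃ₐ[K] M)) (Set.uIcc 0 u) := by
    intro t ht
    rw [Set.uIcc_of_le hu] at ht
    dsimp only
    rw [h0, Subgroup.relIndex_top_right, ← card_lowerRamificationGroup hmem ht.1,
      ← Nat.card_eq_fintype_card, ← Subgroup.card_mul_index (lowerRamificationGroup A K₀ K M t)]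
    have h1 : (Nat.card (lowerRamificationGroup A K₀ K M t) : ℝ) ≠ 0 := by
      exact_mod_cast Nat.card_pos.ne'
    have h2 : ((lowerRamificationGroup A K₀ K M t).index : ℝ) ≠ 0 := by
      exact_mod_cast Subgroup.index_ne_zero_of_finite
    push_cast
    field_simp
  have hint : IntervalIntegrable (fun t : ℝ => ∑ g ∈ Finset.univ.erase (1 : M ≃ₐ[K] M),
      if t + 1 ≤ i g then (1 : ℝ) else 0) MeasureTheory.volume 0 u := by
    have := IntervalIntegrable.sum (Finset.univ.erase (1 : M ≃ₐ[K] M))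
      fun g _ => intervalIntegrable_ite_add_one_le (i g) 0 u
    simpa only [Finset.sum_fn] using this
  rw [herbrandPhi, intervalIntegral.integral_congr hcongr, intervalIntegral.integral_div,
    intervalIntegral.integral_add (by simp) hint,
    intervalIntegral.integral_finsetSum fun g _ => intervalIntegrable_ite_add_one_le _ _ _]
  congr 2
  · simp
  · exact Finset.sum_congr rfl fun g hg =>
      integral_ite_add_one_le (hi g (Finset.ne_of_mem_erase hg)) hu

include hi hmem in
theorem strictMonoOn_herbrandPhi : StrictMonoOn (herbrandPhi A K₀ K M) (Set.Ici 0) := by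
  intro u hu v hv huv
  rw [herbrandPhi_eq hi hmem hu, herbrandPhi_eq hi hmem hv]
  have : (0 : ℝ) < Fintype.card (M ≃ₐ[K] M) := by exact_mod_cast Fintype.card_pos
  refine div_lt_div_of_pos_right ?_ this
  exact add_lt_add_of_lt_of_le huv (Finset.sum_le_sum fun g _ => min_le_min_left _ huv.le)

include hi hmem in
theorem surjOn_herbrandPhi : Set.SurjOn (herbrandPhi A K₀ K M) (Set.Ici 0) (Set.Ici 0) := by
  have hc : (0 : ℝ) < Fintype.card (M ≃ₐ[K] M) := by exact_mod_cast Fintype.card_pos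
  have hnn : ∀ u : ℝ, 0 ≤ u →
      0 ≤ ∑ g ∈ Finset.univ.erase (1 : M ≃ₐ[K] M), min ((i g : ℝ) - 1) u := by
    refine fun u hu => Finset.sum_nonneg fun g hg => le_min ?_ hu
    have := hi g (Finset.ne_of_mem_erase hg)
    rw [sub_nonneg]
    exact_mod_cast this
  intro v hv
  have hv : 0 ≤ v := hv
  -- At this point `φ(u) ≥ u / |G| = v`, so the intermediate value theorem applies on `[0, u]`.
  set u : ℝ := v * Fintype.card (M ≃ₐ[K] M)
  have hu : 0 ≤ u := by positivity
  have hcont : ContinuousOn (herbrandPhi A K₀ K M) (Set.Icc 0 u) := by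
    refine ContinuousOn.congr (f := fun u => (u + ∑ g ∈ Finset.univ.erase (1 : M ≃ₐ[K] M),
      min ((i g : ℝ) - 1) u) / Fintype.card (M ≃ₐ[K] M)) ?_
      fun w hw => herbrandPhi_eq hi hmem hw.1
    fun_prop
  have hmem' : v ∈ Set.Icc (herbrandPhi A K₀ K M 0) (herbrandPhi A K₀ K M u) := by
    constructor
    · simpa [herbrandPhi] using hv
    · rw [herbrandPhi_eq hi hmem hu, le_div_iff₀ hc]
      linarith [hnn u hu]
  obtain ⟨w, hw, rfl⟩ := intermediate_value_Icc hu hcont hmem'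
  exact ⟨w, hw.1, rfl⟩

include hi hmem in
/-- The conductor is `φ` evaluated at the last jump `m` of the lower numbering. -/
theorem conductor_eq {m : ℕ} (hm : ∀ g ≠ 1, i g ≤ m + 1)
    (hm' : (Fintype.card (M ≃ₐ[K] M) = 1 ∧ m = 0) ∨ ∃ g ≠ 1, i g = m + 1) :
    conductor A K₀ K M =
      (m + 1 + ∑ g ∈ Finset.univ.erase (1 : M ≃ₐ[K] M), (i g : ℝ)) /
        Fintype.card (M ≃ₐ[K] M) - 1 := by
  have hc : (0 : ℝ) < Fintype.card (M ≃ₐ[K] M) := by exact_mod_cast Fintype.card_pos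
  rcases hm' with ⟨h1, rfl⟩ | ⟨g₀, hg₀, hg₀m⟩
  -- For the trivial group the set of jumps is empty; `sSup ∅ = 0` agrees with the formula at `m =
  -- 0`.
  · have hsub : Subsingleton (M ≃ₐ[K] M) := Fintype.card_le_one_iff_subsingleton.mp h1.le
    have : Finset.univ.erase (1 : M ≃ₐ[K] M) = ∅ := by
      ext g; simp [Subsingleton.elim g 1]
    rw [h1, this, conductor]
    have hempty : {j : ℝ | 0 ≤ j ∧ upperRamificationGroup A K₀ K M j ≠ ⊥} = ∅ := by
      ext j; simp [Subsingleton.elim (upperRamificationGroup A K₀ K M j) ⊥]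
    rw [hempty]
    simp
  · have hval : herbrandPhi A K₀ K M m =
        (m + 1 + ∑ g ∈ Finset.univ.erase (1 : M ≃ₐ[K] M), (i g : ℝ)) /
          Fintype.card (M ≃ₐ[K] M) - 1 := by
      have hs : ∑ g ∈ Finset.univ.erase (1 : M ≃ₐ[K] M), min ((i g : ℝ) - 1) m =
          ∑ g ∈ Finset.univ.erase (1 : M ≃ₐ[K] M), (i g : ℝ) -
            (Fintype.card (M ≃ₐ[K] M) - 1) := by
        have : ∀ g ∈ Finset.univ.erase (1 : M ≃ₐ[K] M), min ((i g : ℝ) - 1) m = i g - 1 := by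
          intro g hg
          apply min_eq_left
          have := hm g (Finset.ne_of_mem_erase hg)
          rw [sub_le_iff_le_add]
          exact_mod_cast this
        rw [Finset.sum_congr rfl this, Finset.sum_sub_distrib, Finset.sum_const,
          Finset.card_erase_of_mem (Finset.mem_univ _), Finset.card_univ, nsmul_eq_mul, mul_one,
          Nat.cast_pred Fintype.card_pos]
      rw [herbrandPhi_eq hi hmem m.cast_nonneg, hs]
      field_simp
      ring
    -- `G^j` is nontrivial iff `ψ(j) ≤ m`, that is, iff `j ≤ φ(m)`; the supremum is attained.
    have hset : {j : ℝ | 0 ≤ j ∧ upperRamificationGroup A K₀ K M j ≠ ⊥} =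
        Set.Icc 0 (herbrandPhi A K₀ K M m) := by
      ext j
      simp only [Set.mem_ofPred_eq, Set.mem_Icc]
      refine and_congr_right fun hj => ?_
      have hψ0 : 0 ≤ herbrandPsi A K₀ K M j :=
        Function.invFunOn_mem (surjOn_herbrandPhi hi hmem hj)
      have hφψ : herbrandPhi A K₀ K M (herbrandPsi A K₀ K M j) = j :=
        Function.invFunOn_eq (surjOn_herbrandPhi hi hmem hj)
      have hle : j ≤ herbrandPhi A K₀ K M m ↔ herbrandPsi A K₀ K M j ≤ m := by
        conv_lhs => rw [← hφψ]
        exact (strictMonoOn_herbrandPhi hi hmem).le_iff_le hψ0 (Set.mem_Ici.mpr m.cast_nonneg)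
      rw [hle, upperRamificationGroup, Subgroup.ne_bot_iff_exists_ne_one]
      constructor
      · rintro ⟨⟨g, hg⟩, hg1⟩
        have hg1 : g ≠ 1 := fun h => hg1 (Subtype.ext h)
        have h2 := ((hmem _ hψ0 g).mp hg).resolve_left hg1
        have h3 : (i g : ℝ) ≤ m + 1 := by exact_mod_cast hm g hg1
        linarith
      · intro h
        refine ⟨⟨g₀, (hmem _ hψ0 g₀).mpr (Or.inr ?_)⟩, fun h => hg₀ (congrArg Subtype.val h)⟩
        rw [hg₀m]
        push_cast
        linarith
    have hφ0 : 0 ≤ herbrandPhi A K₀ K M m := by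
      rw [show (0 : ℝ) = herbrandPhi A K₀ K M 0 by simp [herbrandPhi]]
      exact (strictMonoOn_herbrandPhi hi hmem).monotoneOn Set.self_mem_Ici
        (Set.mem_Ici.mpr m.cast_nonneg) m.cast_nonneg
    rw [conductor, hset, csSup_Icc hφ0, hval]

end Formula

end Conductor

/-! ### Herbrand's lemma on coset products -/

section Herbrand

open Polynomial

variable {A B G : Type*} [CommRing A] [CommRing B] [Algebra A B]
  [Group G] [MulSemiringAction G B] [SMulCommClass G A B]

theorem smul_aeval (g : G) (f : A[X]) (b : B) : g • aeval b f = aeval (g • b) f :=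
  (aeval_algHom_apply (MulSemiringAction.toAlgHom A B g) b f).symm

/-- If `c = f(z)` with `f` over `A`, then `g c = f(g z)`, and `z - g z` divides `f(z) - f(g z)`. -/
theorem sub_smul_dvd_of_mem_adjoin (g : G) {z c : B} (hc : c ∈ Algebra.adjoin A {z}) :
    z - g • z ∣ c - g • c := by
  rw [Algebra.adjoin_singleton_eq_range_aeval] at hc
  obtain ⟨f, rfl⟩ := hc
  have := sub_dvd_eval_sub z (g • z) (f.map (algebraMap A B))
  rw [eval_map_algebraMap, eval_map_algebraMap, ← smul_aeval] at this
  exact this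

theorem eq_one_of_smul_eq [FaithfulSMul G B] {x : B} (hx : Algebra.adjoin A {x} = ⊤) {g : G}
    (h : g • x = x) : g = 1 := by
  refine FaithfulSMul.eq_of_smul_eq_smul (α := B) fun b => ?_
  have := sub_smul_dvd_of_mem_adjoin (A := A) g (z := x) (c := b) (hx ▸ trivial)
  rw [h, sub_self, zero_dvd_iff, sub_eq_zero] at this
  rw [one_smul, ← this]

/-- **Herbrand's lemma**: if `x` generates `B` and `z` generates the ring fixed by the stabilizer
of `z`, then the displacement of `z` is the product of the displacements of `x` over a coset. -/
theorem associated_prod_sub_smul [IsDomain B] [Fintype G] [DecidableEq B]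
    [FaithfulSMul G B] {x z : B}
    (hx : Algebra.adjoin A {x} = ⊤)
    (hz : ∀ c : B, (∀ h : G, h • z = z → h • c = c) → c ∈ Algebra.adjoin A {z}) (g₀ : G) :
    Associated (∏ g : G with g • z = g₀ • z, (x - g • x)) (z - g₀ • z) := by
  set H : Finset G := Finset.univ.filter fun h => h • z = z with hH
  -- `F` plays the role of the minimal polynomial of `x` over the ring fixed by the stabilizer of
  -- `z`. The coset product is the value at `x` of its conjugate `g₀ • F`.
  set F : B[X] := ∏ h ∈ H, (X - C (h • x)) with hF
  have hprod : ∏ g : G with g • z = g₀ • z, (x - g • x) = (g₀ • F).eval x := by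
    rw [hF, Finset.smul_prod', eval_prod]
    refine (Finset.prod_bij (fun h _ => g₀ * h) ?_ ?_ ?_ ?_).symm
    · intro h hh
      simp only [hH, Finset.mem_filter, Finset.mem_univ, true_and] at hh ⊢
      rw [mul_smul, hh]
    · intro a _ b _ hab
      exact mul_left_cancel hab
    · intro g hg
      simp only [Finset.mem_filter, Finset.mem_univ, true_and] at hg
      refine ⟨g₀⁻¹ * g, ?_, by group⟩
      simp only [hH, Finset.mem_filter, Finset.mem_univ, true_and]
      rw [mul_smul, hg, inv_smul_smul]
    · intro h _
      simp [smul_sub, mul_smul]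
  rw [hprod]
  apply associated_of_dvd_dvd
  -- Write `z = f(x)`. Then `f - z` vanishes at the distinct points `h • x`, so `F` divides it;
  -- applying `g₀` and evaluating at `x` gives the first divisibility.
  · have hzx : z ∈ Algebra.adjoin A {x} := hx ▸ trivial
    rw [Algebra.adjoin_singleton_eq_range_aeval] at hzx
    obtain ⟨f, hf⟩ := hzx
    have hf : aeval x f = z := hf
    have hdvd : F ∣ f.map (algebraMap A B) - C z := by
      rcases eq_or_ne (f.map (algebraMap A B) - C z) 0 with h0 | h0
      · rw [h0]; exact dvd_zero _
      have hinj : Function.Injective fun h : G => h • x := by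
        intro a b hab
        have hab : a • x = b • x := hab
        have : (b⁻¹ * a) • x = x := by rw [mul_smul, hab, inv_smul_smul]
        exact (inv_mul_eq_one.mp (eq_one_of_smul_eq hx this)).symm
      have hFm : F = ((H.val.map fun h => h • x).map fun a => X - C a).prod := by
        rw [Multiset.map_map]; rfl
      rw [hFm, Multiset.prod_X_sub_C_dvd_iff_le_roots h0,
        Multiset.le_iff_subset (H.nodup.map hinj)]
      intro y hy
      obtain ⟨h, hh, rfl⟩ := Multiset.mem_map.mp hy
      have hh : h • z = z := (Finset.mem_filter.mp hh).2
      rw [mem_roots h0, IsRoot, eval_sub, eval_C, eval_map_algebraMap, ← smul_aeval, hf, hh,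
        sub_self]
    obtain ⟨q, hq⟩ := hdvd
    have hq' := congrArg (fun P => (g₀ • P).eval x) hq
    simp only [smul_sub, smul_mul', eval_sub, eval_mul] at hq'
    refine ⟨(g₀ • q).eval x, ?_⟩
    rw [← hq', smul_C, eval_C]
    have : g₀ • f.map (algebraMap A B) = f.map (algebraMap A B) := by
      ext n
      rw [coeff_smul, coeff_map, smul_algebraMap]
    rw [this, eval_map_algebraMap, hf]
  -- The coefficients of `F` are fixed by the stabilizer, hence lie in `A[z]`. So `z - g₀ • z`
  -- divides `(F - g₀ • F)(x) = -(g₀ • F)(x)`.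
  · have hroot : F.eval x = 0 := by
      rw [hF, eval_prod]
      refine Finset.prod_eq_zero (i := 1) (by simp [hH]) (by simp)
    have hcoeff : ∀ n, F.coeff n ∈ Algebra.adjoin A {z} := by
      intro n
      refine hz _ fun h hh => ?_
      have hhF : h • F = F := by
        rw [hF, Finset.smul_prod']
        refine Finset.prod_bij (fun a _ => h * a) ?_ ?_ ?_ ?_
        · intro a ha
          simp only [hH, Finset.mem_filter, Finset.mem_univ, true_and] at ha ⊢
          rw [mul_smul, ha, hh]
        · intro a _ b _ hab
          exact mul_left_cancel hab
        · intro a ha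
          simp only [hH, Finset.mem_filter, Finset.mem_univ, true_and] at ha
          refine ⟨h⁻¹ * a, ?_, by group⟩
          simp only [hH, Finset.mem_filter, Finset.mem_univ, true_and]
          rw [mul_smul, ha, inv_smul_eq_iff, hh]
        · intro a _
          simp [smul_sub, mul_smul]
      rw [← coeff_smul, hhF]
    have : z - g₀ • z ∣ (F - g₀ • F).eval x := by
      rw [eval_eq_sum_range]
      refine Finset.dvd_sum fun n _ => Dvd.dvd.mul_right ?_ _
      rw [coeff_sub, coeff_smul]
      exact sub_smul_dvd_of_mem_adjoin (A := A) g₀ (hcoeff n)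
    rwa [eval_sub, hroot, zero_sub, dvd_neg] at this

end Herbrand

/-! ### Ramification groups read off on a generator -/

section Displacement

variable (A K₀ K M : Type*)
  [CommRing A] [IsDomain A] [IsDiscreteValuationRing A]
  [IsAdicComplete (IsLocalRing.maximalIdeal A) A]
  [Field K₀] [Algebra A K₀] [IsFractionRing A K₀]
  [Field M] [Algebra K₀ M] [Algebra A M] [IsScalarTower A K₀ M]
  [FiniteDimensional K₀ M] [Algebra.IsSeparable K₀ M]
  [Field K] [Algebra K₀ K] [Algebra K M] [IsScalarTower K₀ K M]

omit [IsDomain A] [IsDiscreteValuationRing A] [IsAdicComplete (IsLocalRing.maximalIdeal A) A]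
  [FiniteDimensional K₀ M] [Algebra.IsSeparable K₀ M] in
include K₀ in
theorem faithfulSMul_integralClosure : FaithfulSMul A (integralClosure A M) := by
  rw [faithfulSMul_iff_algebraMap_injective]
  have : Function.Injective (algebraMap A M) := by
    rw [IsScalarTower.algebraMap_eq A K₀ M]
    exact (algebraMap K₀ M).injective.comp (IsFractionRing.injective A K₀)
  rw [IsScalarTower.algebraMap_eq A (integralClosure A M) M, RingHom.coe_comp] at this
  exact Function.Injective.of_comp this

omit [IsDiscreteValuationRing A] [IsAdicComplete (IsLocalRing.maximalIdeal A) A]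
  [Algebra.IsSeparable K₀ M] in
theorem finrank_integralClosure :
    Module.finrank A (integralClosure A M) = Module.finrank K₀ M := by
  have := integralClosure.isFractionRing_of_finite_extension (A := A) K₀ M
  exact (IsFractionRing.finrank_eq A K₀ (integralClosure A M) M).symm

variable {A K₀ K M}

/-- Dictionary between the multiplicative valuation on `M` used in the definitions and the additive
valuation on its ring of integers used in the computations. -/
theorem normalizedValuation_le_exp_iff [IsDiscreteValuationRing (integralClosure A M)]
    (b : integralClosure A M) (n : ℕ) :
    normalizedValuation A K₀ M b ≤ WithZero.exp (-(n : ℤ)) ↔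
      (n : ℕ∞) ≤ IsDiscreteValuationRing.addVal (integralClosure A M) b := by
  have := integralClosure.isFractionRing_of_finite_extension (A := A) K₀ M
  have h : normalizedValuation A K₀ M b =
      (IsDiscreteValuationRing.maximalIdeal (integralClosure A M)).intValuation b :=
    IsDedekindDomain.HeightOneSpectrum.valuation_of_algebraMap _ b
  obtain ⟨π, hπ⟩ := IsDiscreteValuationRing.exists_irreducible (integralClosure A M)
  rw [h, IsDedekindDomain.HeightOneSpectrum.intValuation_le_pow_iff_mem]
  change b ∈ IsLocalRing.maximalIdeal _ ^ n ↔ _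
  rw [hπ.maximalIdeal_eq, Ideal.span_singleton_pow, Ideal.mem_span_singleton,
    ← IsDiscreteValuationRing.addVal_le_iff_dvd, hπ.addVal_pow]

instance smulCommClass_algEquiv : SMulCommClass (M ≃ₐ[K₀] M) A M where
  smul_comm g a m := by
    rw [← algebraMap_smul K₀ a m, smul_comm, algebraMap_smul]

instance faithfulSMul_algEquiv_integralClosure :
    FaithfulSMul (M ≃ₐ[K₀] M) (integralClosure A M) where
  eq_of_smul_eq_smul {g h} hgh := by
    have := integralClosure.isFractionRing_of_finite_extension (A := A) K₀ M
    ext m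
    obtain ⟨a, b, -, rfl⟩ := IsFractionRing.div_surjective (A := integralClosure A M) m
    rw [map_div₀, map_div₀]
    exact congrArg₂ (· / ·) (congrArg Subtype.val (hgh a)) (congrArg Subtype.val (hgh b))

/-- Membership in the lower ramification groups is detected on a generator of the ring of
integers. -/
theorem mem_lowerRamificationGroup_iff [IsDiscreteValuationRing (integralClosure A M)]
    {x : integralClosure A M} (hx : Algebra.adjoin A {x} = ⊤) {t : ℝ} (ht : 0 ≤ t)
    (g : M ≃ₐ[K] M) :
    g ∈ lowerRamificationGroup A K₀ K M t ↔
      ((⌈t⌉₊ + 1 : ℕ) : ℕ∞) ≤ IsDiscreteValuationRing.addVal (integralClosure A M)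
        (x - g.restrictScalars K₀ • x) := by
  have hceil : (⌈t⌉ + 1 : ℤ) = ((⌈t⌉₊ + 1 : ℕ) : ℤ) := by
    push_cast
    rw [Int.natCast_ceil_eq_ceil ht]
  have hiff : ∀ b : integralClosure A M,
      normalizedValuation A K₀ M (g b - b) ≤ WithZero.exp (-(⌈t⌉ + 1)) ↔
      ((⌈t⌉₊ + 1 : ℕ) : ℕ∞) ≤ IsDiscreteValuationRing.addVal (integralClosure A M)
        (b - g.restrictScalars K₀ • b) := by
    intro b
    rw [hceil, ← normalizedValuation_le_exp_iff (K₀ := K₀), Valuation.map_sub_swap]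
    rfl
  constructor
  · intro h
    exact (hiff x).mp (h x x.2)
  · intro h b hb
    refine (hiff ⟨b, hb⟩).mpr (h.trans ?_)
    rw [IsDiscreteValuationRing.addVal_le_iff_dvd]
    exact sub_smul_dvd_of_mem_adjoin (A := A) (g.restrictScalars K₀) (hx ▸ trivial)

end Displacement

/-! ### Valuations of differences of `p`-power roots of unity -/

section Cyclotomic

open Polynomial IsDiscreteValuationRing

variable {B : Type*} [CommRing B] [IsDomain B] [IsDiscreteValuationRing B]

theorem addVal_finsetProd {ι : Type*} (s : Finset ι) (f : ι → B) :
    addVal B (∏ j ∈ s, f j) = ∑ j ∈ s, addVal B (f j) := by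
  classical
  induction s using Finset.induction_on with
  | empty => simp
  | insert a s ha ih => rw [Finset.prod_insert ha, Finset.sum_insert ha, addVal_mul, ih]

theorem addVal_sub_comm (a b : B) : addVal B (a - b) = addVal B (b - a) :=
  AddValuation.map_sub_swap _ _ _

theorem irreducible_of_addVal_eq_one {b : B} (hb : addVal B b = 1) : Irreducible b := by
  obtain ⟨π, hπ⟩ := exists_irreducible B
  rw [← addVal_uniformizer hπ, addVal_eq_iff_associated] at hb
  exact hb.irreducible_iff.mpr hπ

variable {p : ℕ} [hp : Fact p.Prime]

/-- The valuation of `p` in terms of that of `η - 1`, for a primitive root of unity `η` of order a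
power of `p`. -/
theorem addVal_prime_eq {n : ℕ} {η : B} (hη : IsPrimitiveRoot η (p ^ (n + 1))) :
    addVal B (p : B) = (Nat.totient (p ^ (n + 1)) : ℕ∞) * addVal B (η - 1) := by
  -- `p` is the value at 1 of the cyclotomic polynomial, that is, `∏ (1 - μ)` over primitive roots,
  -- and all these factors are associated.
  have h := eval_one_cyclotomic_prime_pow (R := B) (p := p) n
  rw [cyclotomic_eq_prod_X_sub_primitiveRoots hη, eval_prod] at h
  have hpos : 0 < p ^ (n + 1) := pow_pos hp.out.pos _
  rw [← h, addVal_finsetProd, ← hη.card_primitiveRoots, ← nsmul_eq_mul]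
  refine Finset.sum_eq_card_nsmul fun μ hμ => ?_
  rw [eval_sub, eval_X, eval_C, addVal_sub_comm, eq_comm, addVal_eq_iff_associated]
  have : NeZero (p ^ (n + 1)) := ⟨hpos.ne'⟩
  obtain ⟨j, -, hj, rfl⟩ := (hη.isPrimitiveRoot_iff).mp ((mem_primitiveRoots hpos).mp hμ)
  exact hη.associated_sub_one_pow_sub_one_of_coprime hj

/-- For a nontrivial root of unity `ξ` of `p`-power order, `v(ξ - 1) ≤ v(p) / (p - 1)`. -/
theorem mul_addVal_sub_one_le {n : ℕ} {ξ : B} (hξ : ξ ^ p ^ n = 1) (hξ1 : ξ ≠ 1) :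
    ((p - 1 : ℕ) : ℕ∞) * addVal B (ξ - 1) ≤ addVal B (p : B) := by
  obtain ⟨m, -, hm⟩ := (Nat.dvd_prime_pow hp.out).mp (orderOf_dvd_of_pow_eq_one hξ)
  obtain ⟨m, rfl⟩ : ∃ r, m = r + 1 := by
    refine Nat.exists_eq_succ_of_ne_zero fun h => hξ1 ?_
    rwa [h, pow_zero, orderOf_eq_one_iff] at hm
  have hprim : IsPrimitiveRoot ξ (p ^ (m + 1)) := hm ▸ IsPrimitiveRoot.orderOf ξ
  rw [addVal_prime_eq hprim, Nat.totient_prime_pow_succ hp.out]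
  gcongr
  exact Nat.le_mul_of_pos_left _ (pow_pos hp.out.pos _)

/-- The valuation of the different of the `p ^ l`-th cyclotomic extension. -/
theorem addVal_prod_sub_primitiveRoots [CharZero B] [DecidableEq B] {l : ℕ} {ζ η : B}
    (hζ : IsPrimitiveRoot ζ (p ^ (l + 1))) (hη : η = ζ ^ p ^ l) :
    ∑ μ ∈ (primitiveRoots (p ^ (l + 1)) B).erase ζ, addVal B (ζ - μ) + addVal B (η - 1) =
      ((l + 1 : ℕ) : ℕ∞) * addVal B (p : B) := by
  have hpos : 0 < p ^ (l + 1) := pow_pos hp.out.pos _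
  have hmem : ζ ∈ primitiveRoots (p ^ (l + 1)) B := (mem_primitiveRoots hpos).mpr hζ
  have hcyc := cyclotomic_prime_pow_mul_X_pow_sub_one B p l
  have hroot : (cyclotomic (p ^ (l + 1)) B).eval ζ = 0 := by
    rw [cyclotomic_eq_prod_X_sub_primitiveRoots hζ, eval_prod]
    exact Finset.prod_eq_zero hmem (by simp)
  have hder : (derivative (cyclotomic (p ^ (l + 1)) B)).eval ζ =
      ∏ μ ∈ (primitiveRoots (p ^ (l + 1)) B).erase ζ, (ζ - μ) := by
    rw [cyclotomic_eq_prod_X_sub_primitiveRoots hζ, ← Finset.mul_prod_erase _ _ hmem,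
      derivative_mul]
    simp [eval_prod]
  -- Differentiating `Φ · (X ^ p ^ l - 1) = X ^ p ^ (l + 1) - 1` at `ζ` gives `Φ'(ζ)(η - 1) = p ^ (l
  -- + 1) ζ ^ (p ^ (l + 1) - 1)`, and `ζ` is a unit.
  have h := congrArg (fun P => (derivative P).eval ζ) hcyc
  simp only [derivative_mul, eval_add, eval_mul, hroot, hder, derivative_sub, derivative_X_pow,
    derivative_one, eval_sub, eval_pow, eval_X, eval_one, zero_mul, add_zero, sub_zero,
    eval_C, Nat.cast_pow] at h
  have hu : IsUnit ζ := hζ.isUnit hpos.ne'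
  have hv := congrArg (addVal B) h
  rw [addVal_mul, addVal_mul, addVal_pow, addVal_pow, addVal_eq_zero_iff.mpr hu, nsmul_zero,
    add_zero, addVal_finsetProd, ← hη, nsmul_eq_mul] at hv
  exact hv

end Cyclotomic

/-! ### The cyclotomic extension of an absolutely unramified field -/

section CyclotomicExtension

open Polynomial IsDiscreteValuationRing

variable {A K₀ L : Type*} [CommRing A] [IsDomain A] [IsDiscreteValuationRing A]
  [IsAdicComplete (IsLocalRing.maximalIdeal A) A] [IsAlgClosed (IsLocalRing.ResidueField A)]
  [Field K₀] [Algebra A K₀] [IsFractionRing A K₀]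
  [Field L] [Algebra K₀ L] [Algebra A L] [IsScalarTower A K₀ L]
  [FiniteDimensional K₀ L] [Algebra.IsSeparable K₀ L]

omit [IsAdicComplete (IsLocalRing.maximalIdeal A) A] in
variable (K₀) in
/-- The normalized valuation of a uniformizer of the base is the degree of the extension. -/
theorem addVal_algebraMap_integralClosure [IsDiscreteValuationRing (integralClosure A L)]
    {ϖ : A} (hϖ : Irreducible ϖ) :
    addVal (integralClosure A L) (algebraMap A (integralClosure A L) ϖ) =
      Module.finrank K₀ L := by
  have := IsIntegralClosure.finite A K₀ L (integralClosure A L)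
  have := faithfulSMul_integralClosure A K₀ L
  rw [addVal_algebraMap_uniformizer hϖ, finrank_integralClosure A K₀ L]

omit [IsAdicComplete (IsLocalRing.maximalIdeal A) A] in
variable (K₀) in
include K₀ in
theorem adjoin_uniformizer_integralClosure_eq_top
    [IsDiscreteValuationRing (integralClosure A L)] {π : integralClosure A L}
    (hπ : Irreducible π) : Algebra.adjoin A {π} = ⊤ := by
  have := IsIntegralClosure.finite A K₀ L (integralClosure A L)
  have := faithfulSMul_integralClosure A K₀ L
  exact adjoin_uniformizer_eq_top hπ

variable {p : ℕ} [hp : Fact p.Prime] {n : ℕ} {ζ : L}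

omit [IsAdicComplete (IsLocalRing.maximalIdeal A) A] in
/-- The `p ^ (n + 1)`-th cyclotomic extension of an absolutely unramified field is totally
ramified of degree `φ(p ^ (n + 1))`, with uniformizer `ζ - 1`. -/
theorem finrank_and_irreducible_zeta_sub_one [IsDiscreteValuationRing (integralClosure A L)]
    (hpA : Irreducible (p : A)) [IsCyclotomicExtension {p ^ (n + 1)} K₀ L]
    {z : integralClosure A L} (hz : IsPrimitiveRoot z (p ^ (n + 1))) :
    Module.finrank K₀ L = Nat.totient (p ^ (n + 1)) ∧ Irreducible (z - 1) := by
  have hpos : 0 < p ^ (n + 1) := pow_pos hp.out.pos _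
  have : NeZero (p ^ (n + 1)) := ⟨hpos.ne'⟩
  have hzL : IsPrimitiveRoot (z : L) (p ^ (n + 1)) :=
    hz.map_of_injective (f := algebraMap (integralClosure A L) L) Subtype.val_injective
  -- Both sides compute `v(p)`: `[L : K₀] = φ(p ^ (n + 1)) · v(z - 1)`. As the degree is at most
  -- `φ(p ^ (n + 1))`, the valuation of `z - 1` must be 1.
  have h1 := addVal_algebraMap_integralClosure (L := L) K₀ hpA
  rw [map_natCast, addVal_prime_eq hz] at h1
  have hle : Module.finrank K₀ L ≤ Nat.totient (p ^ (n + 1)) := by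
    rw [(hzL.powerBasis K₀).finrank, IsPrimitiveRoot.powerBasis_dim,
      ← natDegree_cyclotomic (p ^ (n + 1)) K₀]
    refine natDegree_le_of_dvd (minpoly.dvd K₀ _ ?_) (cyclotomic_ne_zero _ _)
    rw [← eval_map_algebraMap, map_cyclotomic]
    exact hzL.isRoot_cyclotomic hpos
  have hφ : 0 < Nat.totient (p ^ (n + 1)) := Nat.totient_pos.mpr hpos
  have hd : 0 < Module.finrank K₀ L := Module.finrank_pos
  have hne : addVal (integralClosure A L) (z - 1) ≠ ⊤ := by
    intro h
    rw [h, ENat.mul_top (by exact_mod_cast hφ.ne')] at h1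
    exact ENat.natCast_ne_top _ h1.symm
  obtain ⟨v, hv⟩ := ENat.ne_top_iff_exists.mp hne
  rw [← hv] at h1
  norm_cast at h1
  have hv0 : v ≠ 0 := by
    rintro rfl
    omega
  have hv1 : v = 1 := by
    have : Nat.totient (p ^ (n + 1)) * v ≤ Nat.totient (p ^ (n + 1)) * 1 := by omega
    have := Nat.le_of_mul_le_mul_left this hφ
    omega
  subst hv1
  exact ⟨by omega, irreducible_of_addVal_eq_one (by rw [← hv]; rfl)⟩

/-- Since `ζ - 1` is a uniformizer of a totally ramified extension, it generates the ring of
integers, and `A[ζ - 1] = A[ζ]`. -/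
theorem finrank_eq_totient (hpA : Irreducible (p : A))
    [IsCyclotomicExtension {p ^ (n + 1)} K₀ L] (hζ : IsPrimitiveRoot ζ (p ^ (n + 1))) :
    Module.finrank K₀ L = Nat.totient (p ^ (n + 1)) ∧
      ∀ y : L, IsIntegral A y → ∃ f : A[X], aeval ζ f = y := by
  have hpos : 0 < p ^ (n + 1) := pow_pos hp.out.pos _
  have := isDiscreteValuationRing_integralClosure A K₀ L
  obtain ⟨z, rfl⟩ : ∃ z : integralClosure A L, (z : L) = ζ :=
    ⟨⟨ζ, hζ.isIntegral hpos |>.tower_top⟩, rfl⟩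
  have hz : IsPrimitiveRoot z (p ^ (n + 1)) :=
    hζ.of_map_of_injective (f := algebraMap (integralClosure A L) L) Subtype.val_injective
  obtain ⟨hfin, hirr⟩ := finrank_and_irreducible_zeta_sub_one (K₀ := K₀) hpA hz
  refine ⟨hfin, fun y hy => ?_⟩
  have htop := adjoin_uniformizer_integralClosure_eq_top K₀ hirr
  have hmem : (⟨y, hy⟩ : integralClosure A L) ∈ Algebra.adjoin A {z - 1} := htop ▸ trivial
  rw [Algebra.adjoin_singleton_eq_range_aeval] at hmem
  obtain ⟨f, hf⟩ := hmem
  refine ⟨f.comp (X - 1), ?_⟩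
  have hf : aeval (z - 1) f = ⟨y, hy⟩ := hf
  have := congrArg (algebraMap (integralClosure A L) L) hf
  rw [← aeval_algebraMap_apply] at this
  rw [aeval_comp]
  simpa using this

theorem minpoly_eq_cyclotomic (hpA : Irreducible (p : A))
    [IsCyclotomicExtension {p ^ (n + 1)} K₀ L] (hζ : IsPrimitiveRoot ζ (p ^ (n + 1))) :
    minpoly K₀ ζ = cyclotomic (p ^ (n + 1)) K₀ := by
  have hpos : 0 < p ^ (n + 1) := pow_pos hp.out.pos _
  have : NeZero (p ^ (n + 1)) := ⟨hpos.ne'⟩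
  have hint : IsIntegral K₀ ζ := Algebra.IsIntegral.isIntegral ζ
  refine (eq_of_monic_of_dvd_of_natDegree_le (minpoly.monic hint)
    (cyclotomic.monic _ _) (minpoly.dvd K₀ _ ?_) ?_).symm
  · rw [← eval_map_algebraMap, map_cyclotomic]
    exact hζ.isRoot_cyclotomic hpos
  · rw [natDegree_cyclotomic, ← (finrank_eq_totient (K₀ := K₀) hpA hζ).1,
      (hζ.powerBasis K₀).finrank, IsPrimitiveRoot.powerBasis_dim]

end CyclotomicExtension

/-! ### Combinatorics of the last jump of a group and a subgroup -/

section Jumps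

variable {G H X : Type*} [Group G] [Group H] [Fintype G] [Fintype H] [DecidableEq G]
  [DecidableEq H] [DecidableEq X]

/-- `m + 1` is the largest value of `i` on nontrivial elements; `m = 0` for the trivial group. -/
def IsLastJump (i : G → ℕ) (m : ℕ) : Prop :=
  (∀ g ≠ 1, i g ≤ m + 1) ∧ ((Fintype.card G = 1 ∧ m = 0) ∨ ∃ g ≠ 1, i g = m + 1)

omit [DecidableEq G] in
theorem exists_isLastJump {i : G → ℕ} (hpos : ∀ g ≠ 1, 1 ≤ i g) : ∃ m, IsLastJump i m := by
  classical
  by_cases h : Fintype.card G = 1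
  · have : Subsingleton G := Fintype.card_le_one_iff_subsingleton.mp h.le
    exact ⟨0, fun g hg => absurd (Subsingleton.elim g 1) hg, Or.inl ⟨h, rfl⟩⟩
  · have : Nontrivial G := Fintype.one_lt_card_iff_nontrivial.mp
      (lt_of_le_of_ne Fintype.card_pos (Ne.symm h))
    obtain ⟨g₁, hg₁⟩ := exists_ne (1 : G)
    obtain ⟨g₀, hg₀, hmax⟩ := Finset.exists_max_image (Finset.univ.erase (1 : G)) i
      ⟨g₁, by simp [hg₁]⟩
    have hg₀ := Finset.ne_of_mem_erase hg₀
    refine ⟨i g₀ - 1, fun g hg => ?_, Or.inr ⟨g₀, hg₀, ?_⟩⟩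
    · have := hmax g (by simp [hg])
      omega
    · have := hpos g₀ hg₀
      omega

variable {ρ : H →* G} (hρ : Function.Injective ρ) {c : G → X}
  (hc : ∀ g g', c g' = c g ↔ ∃ h, g' = g * ρ h) {i : G → ℕ}

include hρ hc

-- By `hc` the fibres of `c` are exactly the left cosets of the image of `H`; in the application `c
-- g = g • ζ`.
omit [DecidableEq G] [DecidableEq H] in
theorem sum_fiber_eq (g₀ : G) : ∑ g with c g = c g₀, i g = ∑ h, i (g₀ * ρ h) := by
  refine (Finset.sum_bij (fun h _ => g₀ * ρ h) ?_ ?_ ?_ ?_).symm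
  · intro h _
    simpa using (hc g₀ _).mpr ⟨h, rfl⟩
  · intro a _ b _ hab
    exact hρ (mul_left_cancel hab)
  · intro g hg
    obtain ⟨h, rfl⟩ := (hc g₀ g).mp (Finset.mem_filter.mp hg).2
    exact ⟨h, Finset.mem_univ _, rfl⟩
  · intro h _
    rfl

theorem sum_erase_one_eq :
    ∑ g ∈ Finset.univ.erase (1 : G), i g =
      ∑ h ∈ Finset.univ.erase (1 : H), i (ρ h) + ∑ g with c g ≠ c 1, i g := by
  have h1 := Finset.sum_filter_add_sum_filter_not Finset.univ (fun g => c g = c 1) i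
  rw [sum_fiber_eq hρ hc] at h1
  have h2 := Finset.add_sum_erase Finset.univ i (Finset.mem_univ 1)
  have h3 := Finset.add_sum_erase Finset.univ (fun h => i (1 * ρ h)) (Finset.mem_univ 1)
  simp only [one_mul, map_one, ← ne_eq] at h1 h3
  omega

/-- The combinatorial heart of the comparison of conductors: the last jump of `G` is controlled by
that of `H` and the sums of `i` over the cosets of `H`. -/
theorem lastJump_add_sum_eq_max (hpos : ∀ g ≠ 1, 1 ≤ i g)
    (hmul : ∀ g h, g ≠ 1 → h ≠ 1 → g * h ≠ 1 → min (i g) (i h) ≤ i (g * h))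
    (hinv : ∀ g, i g⁻¹ = i g) {mG mH e : ℕ} (hG : IsLastJump i mG)
    (hH : IsLastJump (fun h => i (ρ h)) mH)
    (hub : ∀ g₀, c g₀ ≠ c 1 → ∑ g with c g = c g₀, i g ≤ e)
    (hlb : ∑ g with c g ≠ c 1, i g + e = Fintype.card G ∨
      ∃ g₀, c g₀ ≠ c 1 ∧ e ≤ ∑ g with c g = c g₀, i g) :
    mG + 1 + ∑ h ∈ Finset.univ.erase (1 : H), i (ρ h) =
      max e (mH + 1 + ∑ h ∈ Finset.univ.erase (1 : H), i (ρ h)) := by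
  have hρ1 : ∀ h, h ≠ 1 → ρ h ≠ 1 := fun h hh => (map_ne_one_iff ρ hρ).mpr hh
  have hmem : ∀ {g₀}, c g₀ ≠ c 1 → ∀ h, g₀ * ρ h ≠ 1 := by
    intro g₀ hg₀ h h1
    exact hg₀ (((hc g₀ 1).mpr ⟨h, h1.symm⟩).symm)
  have hne : ∀ {g₀}, c g₀ ≠ c 1 → g₀ ≠ 1 := fun h h1 => h (h1 ▸ rfl)
  have hsplit : ∀ g₀, ∑ g with c g = c g₀, i g =
      i g₀ + ∑ h ∈ Finset.univ.erase (1 : H), i (g₀ * ρ h) := by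
    intro g₀
    rw [sum_fiber_eq hρ hc, ← Finset.add_sum_erase Finset.univ _ (Finset.mem_univ 1), map_one,
      mul_one]
  have hle : mH ≤ mG := by
    rcases hH.2 with ⟨-, rfl⟩ | ⟨h, hh, hhm⟩
    · exact Nat.zero_le _
    · have h1 := hG.1 (ρ h) (hρ1 h hh)
      have h2 : i (ρ h) = mH + 1 := hhm
      omega
  have he : e ≤ mG + 1 + ∑ h ∈ Finset.univ.erase (1 : H), i (ρ h) := by
    -- The first alternative serves `n = 0`, where a nontrivial coset need not exist. There `R + e =
    -- |G| ≤ 1 + T + R`, because every `i g` with `g ≠ 1` is at least 1.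
    rcases hlb with hsum | ⟨g₁, hg₁, hg₁e⟩
    · have hcard : Fintype.card G ≤ 1 + ∑ g ∈ Finset.univ.erase (1 : G), i g := by
        have : (Finset.univ.erase (1 : G)).card • 1 ≤ ∑ g ∈ Finset.univ.erase (1 : G), i g :=
          Finset.card_nsmul_le_sum _ _ _ fun g hg => hpos g (Finset.ne_of_mem_erase hg)
        rw [Finset.card_erase_of_mem (Finset.mem_univ _), Finset.card_univ, smul_eq_mul] at this
        omega
      rw [sum_erase_one_eq hρ hc] at hcard
      omega
    -- Choose `g₀` maximizing `i` on the coset. Then `h = g₀⁻¹ (g₀ h)` gives `i (g₀ h) ≤ i h`, so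
    -- the coset sum is at most `i g₀ + T`.
    · obtain ⟨g₀, hg₀, hmax⟩ := Finset.exists_max_image
        (Finset.univ.filter fun g => c g = c g₁) i ⟨g₁, by simp⟩
      have hg₀ : c g₀ = c g₁ := (Finset.mem_filter.mp hg₀).2
      rw [← hg₀] at hg₁ hg₁e hmax
      rw [hsplit] at hg₁e
      refine hg₁e.trans (Nat.add_le_add (hG.1 g₀ (hne hg₁)) (Finset.sum_le_sum fun h hh => ?_))
      have hh := hρ1 h (Finset.ne_of_mem_erase hh)
      have h1 := hmul g₀⁻¹ (g₀ * ρ h) (inv_ne_one.mpr (hne hg₁)) (hmem hg₁ h)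
        (by rwa [inv_mul_cancel_left])
      rw [inv_mul_cancel_left, hinv, min_eq_right] at h1
      · exact h1
      · exact hmax _ (by simpa using (hc g₀ _).mpr ⟨h, rfl⟩)
  rcases hle.eq_or_lt with rfl | hlt
  · rw [max_eq_right he]
  -- If `mH < mG`, an element attaining the last jump lies outside `H`. Since `i h ≤ i g₀`, one has
  -- `i (g₀ h) ≥ i h`, so `mG + 1 + T` is at most the coset sum, hence at most `e`.
  · obtain ⟨g₀, hg₀, hg₀m⟩ := hG.2.resolve_left (by rintro ⟨-, rfl⟩; omega)
    have hg₀c : c g₀ ≠ c 1 := by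
      intro hcg
      obtain ⟨h, hh⟩ := (hc 1 g₀).mp hcg
      rw [one_mul] at hh
      subst hh
      have hh1 : h ≠ 1 := fun h1 => hg₀ (by rw [h1, map_one])
      have : i (ρ h) ≤ mH + 1 := hH.1 h hh1
      omega
    have h1 := hub g₀ hg₀c
    rw [hsplit] at h1
    have h2 : ∑ h ∈ Finset.univ.erase (1 : H), i (ρ h) ≤
        ∑ h ∈ Finset.univ.erase (1 : H), i (g₀ * ρ h) := by
      refine Finset.sum_le_sum fun h hh => ?_
      have hh := Finset.ne_of_mem_erase hh
      have h3 := hmul g₀ (ρ h) hg₀ (hρ1 h hh) (hmem hg₀c h)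
      have h4 : i (ρ h) ≤ mH + 1 := hH.1 h hh
      rw [min_eq_right (by omega)] at h3
      exact h3
    rw [max_eq_left (by omega)]
    omega

end Jumps

/-! ### The cyclotomic subextension inside the Galois extension -/

section CyclotomicSubextension

open Polynomial IsDiscreteValuationRing

variable {A K₀ L M : Type*} [CommRing A] [IsDomain A] [IsDiscreteValuationRing A]
  [IsAdicComplete (IsLocalRing.maximalIdeal A) A] [IsAlgClosed (IsLocalRing.ResidueField A)]
  [Field K₀] [CharZero K₀] [Algebra A K₀] [IsFractionRing A K₀]
  [Field L] [Algebra K₀ L] [Field M] [Algebra K₀ M] [Algebra L M] [IsScalarTower K₀ L M]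
  [Algebra A M] [IsScalarTower A K₀ M] [FiniteDimensional K₀ M]

variable {p : ℕ} [hp : Fact p.Prime] {n : ℕ}

section Fixed

variable [IsGalois K₀ M] [IsCyclotomicExtension {p ^ (n + 1)} K₀ L] {ζ : L}
  (hζ : IsPrimitiveRoot ζ (p ^ (n + 1)))

include hζ

omit [CharZero K₀] [FiniteDimensional K₀ M] [IsGalois K₀ M] in
/-- An automorphism of `M` fixing `ζ` is an automorphism over `K₀(ζ)`. -/
theorem exists_restrictScalars_eq {g : M ≃ₐ[K₀] M} (hg : g (algebraMap L M ζ) = algebraMap L M ζ) :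
    ∃ h : M ≃ₐ[L] M, h.restrictScalars K₀ = g := by
  have : NeZero (p ^ (n + 1)) := ⟨(pow_pos hp.out.pos _).ne'⟩
  have hfix : (g : M →ₐ[K₀] M).comp (IsScalarTower.toAlgHom K₀ L M) =
      IsScalarTower.toAlgHom K₀ L M := (hζ.powerBasis K₀).algHom_ext (by simpa using hg)
  exact ⟨AlgEquiv.ofRingEquiv (f := g.toRingEquiv) fun x => DFunLike.congr_fun hfix x, rfl⟩

/-- The integral elements fixed by the stabilizer of `ζ` lie in `A[ζ]`. -/
theorem mem_adjoin_of_fixed (hpA : Irreducible (p : A)) {z : integralClosure A M}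
    (hz : (z : M) = algebraMap L M ζ) (c : integralClosure A M)
    (hc : ∀ h : M ≃ₐ[K₀] M, h • z = z → h • c = c) : c ∈ Algebra.adjoin A {z} := by
  have := FiniteDimensional.right K₀ L M
  have := FiniteDimensional.left K₀ L M
  have := IsGalois.tower_top_of_isGalois K₀ L M
  let _ : Algebra A L := ((algebraMap K₀ L).comp (algebraMap A K₀)).toAlgebra
  have : IsScalarTower A K₀ L := IsScalarTower.of_algebraMap_eq fun _ => rfl
  have : IsScalarTower A L M := IsScalarTower.of_algebraMap_eq fun a => by
    rw [IsScalarTower.algebraMap_apply A K₀ M, IsScalarTower.algebraMap_apply K₀ L M]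
    rfl
  -- The stabilizer of `ζ` contains `Gal(M/L)`, so `c` descends to an integral element of `L`, where
  -- `A[ζ]` is everything integral.
  obtain ⟨y, hy⟩ : (c : M) ∈ Set.range (algebraMap L M) := by
    rw [IsGalois.mem_range_algebraMap_iff_fixed]
    intro h
    have := hc (h.restrictScalars K₀) (Subtype.ext (by
      change h z = z
      rw [hz, h.commutes]))
    exact congrArg Subtype.val this
  have hyint : IsIntegral A y := by
    rw [← isIntegral_algebraMap_iff (algebraMap L M).injective, hy]
    exact c.2
  obtain ⟨f, hf⟩ := (finrank_eq_totient (K₀ := K₀) hpA hζ).2 y hyint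
  rw [Algebra.adjoin_singleton_eq_range_aeval]
  refine ⟨f, Subtype.ext ?_⟩
  change algebraMap (integralClosure A M) M (aeval z f) = c
  rw [← aeval_algebraMap_apply, ← hy, ← hf, ← aeval_algebraMap_apply, ← hz]
  rfl

/-- The Galois group acts transitively on the primitive roots of unity. -/
theorem exists_smul_eq_of_isPrimitiveRoot (hpA : Irreducible (p : A)) {z μ : integralClosure A M}
    (hz : (z : M) = algebraMap L M ζ) (hμ : IsPrimitiveRoot μ (p ^ (n + 1))) :
    ∃ g : M ≃ₐ[K₀] M, g • z = μ := by
  have := FiniteDimensional.left K₀ L M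
  let _ : Algebra A L := ((algebraMap K₀ L).comp (algebraMap A K₀)).toAlgebra
  have : IsScalarTower A K₀ L := IsScalarTower.of_algebraMap_eq fun _ => rfl
  have hμM : IsPrimitiveRoot (μ : M) (p ^ (n + 1)) :=
    hμ.map_of_injective (f := algebraMap (integralClosure A M) M) Subtype.val_injective
  obtain ⟨g, hg⟩ := minpoly.exists_algEquiv_of_root' (K := K₀) (x := (μ : M)) (y := (z : M))
    (Algebra.IsAlgebraic.isAlgebraic _) (by
      rw [hz, minpoly.algebraMap_eq (algebraMap L M).injective,
        minpoly_eq_cyclotomic (A := A) hpA hζ, ← eval_map_algebraMap, map_cyclotomic]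
      exact hμM.isRoot_cyclotomic (pow_pos hp.out.pos _))
  exact ⟨g, Subtype.ext hg⟩

end Fixed

end CyclotomicSubextension

open Polynomial IsDiscreteValuationRing

/-! ### The displacement function -/

section Displacement

variable {A K₀ K M : Type*} [CommRing A] [IsDomain A] [IsDiscreteValuationRing A]
  [IsAdicComplete (IsLocalRing.maximalIdeal A) A]
  [Field K₀] [Algebra A K₀] [IsFractionRing A K₀]
  [Field M] [Algebra K₀ M] [Algebra A M] [IsScalarTower A K₀ M]
  [FiniteDimensional K₀ M] [Algebra.IsSeparable K₀ M]
  [Field K] [Algebra K₀ K] [Algebra K M] [IsScalarTower K₀ K M]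
  [IsDiscreteValuationRing (integralClosure A M)]

/-- The valuation of `x - g x`, as a natural number (`0` if `g x = x`). -/
noncomputable def displacement (x : integralClosure A M) (g : M ≃ₐ[K₀] M) : ℕ :=
  (addVal (integralClosure A M) (x - g • x)).toNat

variable {x : integralClosure A M} (hx : Algebra.adjoin A {x} = ⊤)

include hx

omit [IsDiscreteValuationRing A] [IsAdicComplete (IsLocalRing.maximalIdeal A) A]
  [Algebra.IsSeparable K₀ M] in
theorem coe_displacement {g : M ≃ₐ[K₀] M} (hg : g ≠ 1) :
    (displacement x g : ℕ∞) = addVal (integralClosure A M) (x - g • x) := by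
  refine ENat.natCast_toNat fun h => hg ?_
  rw [addVal_eq_top_iff, sub_eq_zero] at h
  exact eq_one_of_smul_eq hx h.symm

/-- The same function on `Gal(M/K₀)` serves every intermediate `K`: lower numbering restricts to
subgroups. The identity is separated because its displacement takes the default value 0. -/
theorem mem_lowerRamificationGroup_iff_displacement {t : ℝ} (ht : 0 ≤ t) (g : M ≃ₐ[K] M) :
    g ∈ lowerRamificationGroup A K₀ K M t ↔
      g = 1 ∨ t + 1 ≤ displacement x (g.restrictScalars K₀) := by
  by_cases hg : g = 1
  · simp [hg, one_mem]
  · have hg' : g.restrictScalars K₀ ≠ 1 := fun h => hg (AlgEquiv.restrictScalars_injective K₀ h)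
    rw [mem_lowerRamificationGroup_iff hx ht, ← coe_displacement hx hg', Nat.cast_le,
      or_iff_right hg, ← Nat.ceil_add_one ht, Nat.ceil_le]

/-- Both elements lie in the ramification group of index `m - 1`, `m` being the minimum, and it is
closed under multiplication. -/
theorem min_displacement_le {g h : M ≃ₐ[K₀] M} (hg : 1 ≤ displacement x g)
    (hh : 1 ≤ displacement x h) (hgh : g * h ≠ 1) :
    min (displacement x g) (displacement x h) ≤ displacement x (g * h) := by
  set m := min (displacement x g) (displacement x h)
  have hm : 1 ≤ m := le_min hg hh
  have ht : (0 : ℝ) ≤ (m : ℝ) - 1 := by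
    rw [sub_nonneg]; exact_mod_cast hm
  have hiff : ∀ g : M ≃ₐ[K₀] M, g ∈ lowerRamificationGroup A K₀ K₀ M (m - 1) ↔
      g = 1 ∨ (m - 1 : ℝ) + 1 ≤ displacement x g :=
    mem_lowerRamificationGroup_iff_displacement hx ht
  have h1 := (hiff g).mpr (Or.inr (by
    rw [sub_add_cancel]; exact_mod_cast min_le_left _ _))
  have h2 := (hiff h).mpr (Or.inr (by
    rw [sub_add_cancel]; exact_mod_cast min_le_right _ _))
  have h3 := ((hiff _).mp (mul_mem h1 h2)).resolve_left hgh
  rw [sub_add_cancel] at h3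
  exact_mod_cast h3

theorem displacement_inv (hpos : ∀ g : M ≃ₐ[K₀] M, g ≠ 1 → 1 ≤ displacement x g)
    (g : M ≃ₐ[K₀] M) : displacement x g⁻¹ = displacement x g := by
  have key : ∀ g : M ≃ₐ[K₀] M, g ≠ 1 → displacement x g ≤ displacement x g⁻¹ := by
    intro g hg
    have ht : (0 : ℝ) ≤ (displacement x g : ℝ) - 1 := by
      rw [sub_nonneg]; exact_mod_cast hpos g hg
    have hiff : ∀ g' : M ≃ₐ[K₀] M,
        g' ∈ lowerRamificationGroup A K₀ K₀ M (displacement x g - 1) ↔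
        g' = 1 ∨ (displacement x g - 1 : ℝ) + 1 ≤ displacement x g' :=
      mem_lowerRamificationGroup_iff_displacement hx ht
    have h1 := (hiff g).mpr (Or.inr (by rw [sub_add_cancel]))
    have h2 := ((hiff _).mp (inv_mem h1)).resolve_left (inv_ne_one.mpr hg)
    rw [sub_add_cancel] at h2
    exact_mod_cast h2
  by_cases hg : g = 1
  · rw [hg, inv_one]
  · refine le_antisymm ?_ (key g hg)
    simpa using key g⁻¹ (inv_ne_one.mpr hg)

end Displacement

/-- A uniformizer and its conjugate both lie in the maximal ideal, so their difference does too. -/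
theorem one_le_displacement {A K₀ M : Type*} [CommRing A] [IsDomain A] [IsDiscreteValuationRing A]
    [IsAdicComplete (IsLocalRing.maximalIdeal A) A]
    [Field K₀] [Algebra A K₀] [IsFractionRing A K₀]
    [Field M] [Algebra K₀ M] [Algebra A M] [IsScalarTower A K₀ M]
    [FiniteDimensional K₀ M] [Algebra.IsSeparable K₀ M]
    [IsDiscreteValuationRing (integralClosure A M)] {x : integralClosure A M}
    (hx : Algebra.adjoin A {x} = ⊤) (hirr : Irreducible x) {g : M ≃ₐ[K₀] M} (hg : g ≠ 1) :
    1 ≤ displacement x g := by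
  have h : (1 : ℕ∞) ≤ displacement x g := by
    rw [coe_displacement hx hg, Order.one_le_iff_ne_zero, Ne, addVal_eq_zero_iff]
    have h1 : x ∈ nonunits (integralClosure A M) := hirr.not_isUnit
    have h2 : g • x ∈ nonunits (integralClosure A M) := fun h =>
      hirr.not_isUnit (by simpa using h.map (MulSemiringAction.toRingHom _ _ g⁻¹))
    intro h
    rw [← IsLocalRing.mem_maximalIdeal] at h1 h2
    exact (IsLocalRing.mem_maximalIdeal _).mp (sub_mem h1 h2) h
  exact_mod_cast h

/-! ### Coset sums of displacements -/

section CyclotomicSubextension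

variable {A K₀ L M : Type*} [CommRing A] [IsDomain A] [IsDiscreteValuationRing A]
  [IsAdicComplete (IsLocalRing.maximalIdeal A) A] [IsAlgClosed (IsLocalRing.ResidueField A)]
  [Field K₀] [CharZero K₀] [Algebra A K₀] [IsFractionRing A K₀]
  [Field L] [Algebra K₀ L] [Field M] [Algebra K₀ M] [Algebra L M] [IsScalarTower K₀ L M]
  [Algebra A M] [IsScalarTower A K₀ M] [FiniteDimensional K₀ M]
  [IsDiscreteValuationRing (integralClosure A M)]
  {p : ℕ} [hp : Fact p.Prime] {n : ℕ}
  [IsGalois K₀ M] [IsCyclotomicExtension {p ^ (n + 1)} K₀ L] {ζ : L}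
  (hζ : IsPrimitiveRoot ζ (p ^ (n + 1))) (hpA : Irreducible (p : A))
  {x z : integralClosure A M} (hx : Algebra.adjoin A {x} = ⊤)
  (hz : (z : M) = algebraMap L M ζ)

include hζ hpA hx hz

/-- The sum of the displacements of a generator over a nontrivial coset of `Gal(M/K₀(ζ))`. -/
theorem sum_displacement_eq [DecidableEq (integralClosure A M)] {g₀ : M ≃ₐ[K₀] M}
    (hg₀ : g₀ • z ≠ z) :
    ((∑ g : M ≃ₐ[K₀] M with g • z = g₀ • z, displacement x g : ℕ) : ℕ∞) =
      addVal (integralClosure A M) (z - g₀ • z) := by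
  have h := associated_prod_sub_smul hx (mem_adjoin_of_fixed (K₀ := K₀) hζ hpA hz) g₀
  rw [← (addVal_eq_iff_associated _ _).mpr h, addVal_finsetProd, Nat.cast_sum]
  refine Finset.sum_congr rfl fun g hg => coe_displacement hx ?_
  rintro rfl
  have := (Finset.mem_filter.mp hg).2
  rw [one_smul] at this
  exact hg₀ this.symm

omit [IsDomain A] [IsDiscreteValuationRing A] [IsAdicComplete (IsLocalRing.maximalIdeal A) A]
  [IsAlgClosed (IsLocalRing.ResidueField A)] [IsDiscreteValuationRing (integralClosure A M)]
  hp hpA hx in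
theorem isPrimitiveRoot_of_coe_eq : IsPrimitiveRoot z (p ^ (n + 1)) := by
  have h : IsPrimitiveRoot (z : M) (p ^ (n + 1)) :=
    hz ▸ hζ.map_of_injective (algebraMap L M).injective
  exact h.of_map_of_injective (f := algebraMap (integralClosure A M) M) Subtype.val_injective

/-- With `e` the valuation of `η - 1` for a primitive `p`-th root of unity `η`: the coset sums of
displacements are at most `e`, with equality for some coset if `n ≠ 0`, and they add up to the
valuation of the different of `K₀(ζ)/K₀`. -/
theorem exists_sum_displacement [DecidableEq (integralClosure A M)] :
    ∃ e : ℕ, (p - 1) * e = Fintype.card (M ≃ₐ[K₀] M) ∧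
      (∑ g : M ≃ₐ[K₀] M with g • z ≠ (1 : M ≃ₐ[K₀] M) • z, displacement x g) + e =
        (n + 1) * Fintype.card (M ≃ₐ[K₀] M) ∧
      (∀ g₀ : M ≃ₐ[K₀] M, g₀ • z ≠ (1 : M ≃ₐ[K₀] M) • z →
        ∑ g : M ≃ₐ[K₀] M with g • z = g₀ • z, displacement x g ≤ e) ∧
      (n ≠ 0 → ∃ g₀ : M ≃ₐ[K₀] M, g₀ • z ≠ (1 : M ≃ₐ[K₀] M) • z ∧
        e ≤ ∑ g : M ≃ₐ[K₀] M with g • z = g₀ • z, displacement x g) := by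
  simp only [one_smul]
  have hppos : 0 < p ^ (n + 1) := pow_pos hp.out.pos _
  have hp1 : 0 < p - 1 := Nat.sub_pos_of_lt hp.out.one_lt
  have : CharZero M := charZero_of_injective_algebraMap (algebraMap K₀ M).injective
  have : CharZero (integralClosure A M) :=
    ⟨fun a b hab => Nat.cast_injective (R := M) (by simpa using congrArg Subtype.val hab)⟩
  have hzprim := isPrimitiveRoot_of_coe_eq hζ hz
  have hzu : IsUnit z := hzprim.isUnit hppos.ne'
  have hη : IsPrimitiveRoot (z ^ p ^ n) (p ^ (0 + 1)) :=
    hzprim.pow hppos (by ring)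
  -- `p` is a uniformizer of `A` and `M/K₀` is totally ramified, so `v_M(p) = |G|`; comparing with
  -- `v_M(p) = (p - 1) e` determines `e`.
  have hN : addVal (integralClosure A M) (p : integralClosure A M) =
      Fintype.card (M ≃ₐ[K₀] M) := by
    have := addVal_algebraMap_integralClosure (L := M) K₀ hpA
    rwa [map_natCast, ← IsGalois.card_aut_eq_finrank, Nat.card_eq_fintype_card] at this
  have hη1 : z ^ p ^ n - 1 ≠ 0 := by
    rw [sub_ne_zero]
    exact hη.ne_one (by simpa using hp.out.one_lt)
  obtain ⟨e, he⟩ := ENat.ne_top_iff_exists.mp (mt addVal_eq_top_iff.mp hη1)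
  have hpe : (p - 1) * e = Fintype.card (M ≃ₐ[K₀] M) := by
    have := addVal_prime_eq hη
    rw [hN, ← he, zero_add, pow_one, Nat.totient_prime hp.out] at this
    exact_mod_cast this.symm
  have hmapsto : ∀ g : M ≃ₐ[K₀] M, IsPrimitiveRoot (g • z) (p ^ (n + 1)) := fun g =>
    hzprim.map_of_injective (f := MulSemiringAction.toRingHom _ _ g) (MulAction.injective g)
  refine ⟨e, hpe, ?_, ?_, ?_⟩
  -- Group by the value `μ = g • z`. By transitivity every primitive root other than `z` occurs, and
  -- each fibre contributes `v(z - μ)`.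
  · have h1 : ((∑ g : M ≃ₐ[K₀] M with g • z ≠ z, displacement x g : ℕ) : ℕ∞) =
        ∑ μ ∈ (primitiveRoots (p ^ (n + 1)) (integralClosure A M)).erase z,
          addVal (integralClosure A M) (z - μ) := by
      rw [← Finset.sum_fiberwise_of_maps_to
        (t := (primitiveRoots (p ^ (n + 1)) (integralClosure A M)).erase z) (g := fun g => g • z)
        (fun g hg => Finset.mem_erase.mpr
          ⟨(Finset.mem_filter.mp hg).2, (mem_primitiveRoots hppos).mpr (hmapsto g)⟩),
        Nat.cast_sum]
      refine Finset.sum_congr rfl fun μ hμ => ?_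
      obtain ⟨hμz, hμ⟩ := Finset.mem_erase.mp hμ
      obtain ⟨g₀, rfl⟩ := exists_smul_eq_of_isPrimitiveRoot (K₀ := K₀) hζ hpA hz
        ((mem_primitiveRoots hppos).mp hμ)
      rw [← sum_displacement_eq hζ hpA hx hz hμz, Finset.filter_filter]
      congr 2
      ext g
      simp only [Finset.mem_filter, Finset.mem_univ, true_and]
      exact ⟨fun h => h.2, fun h => ⟨h ▸ hμz, h⟩⟩
    have h2 := addVal_prod_sub_primitiveRoots hzprim rfl
    rw [← h1, ← he, hN] at h2
    exact_mod_cast h2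
  · intro g₀ hg₀
    obtain ⟨y, hy⟩ := hzu.exists_right_inv
    -- With `y = z⁻¹`, `ξ` is the root of unity `g₀ z / z`, and `z - g₀ z` is a unit times `ξ - 1`.
    set ξ := g₀ • z * y with hξ
    have hzξ : z - g₀ • z = -(z * (ξ - 1)) := by
      rw [hξ]; linear_combination (g₀ • z) * hy
    have hξ1 : ξ ≠ 1 := by
      intro h
      rw [h, sub_self, mul_zero, neg_zero, sub_eq_zero] at hzξ
      exact hg₀ hzξ.symm
    have hξpow : ξ ^ p ^ (n + 1) = 1 := by
      have h1 : y ^ p ^ (n + 1) = 1 := by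
        have := congrArg (· ^ p ^ (n + 1)) hy
        simpa [mul_pow, hzprim.pow_eq_one] using this
      rw [hξ, mul_pow, (hmapsto g₀).pow_eq_one, h1, one_mul]
    have h1 := mul_addVal_sub_one_le hξpow hξ1
    have h2 : addVal (integralClosure A M) (z - g₀ • z) =
        addVal (integralClosure A M) (ξ - 1) := by
      rw [hzξ, AddValuation.map_neg, addVal_mul, addVal_eq_zero_iff.mpr hzu, zero_add]
    rw [← h2, ← sum_displacement_eq hζ hpA hx hz hg₀, hN, ← hpe] at h1
    have h3 : (p - 1) * ∑ g : M ≃ₐ[K₀] M with g • z = g₀ • z, displacement x g ≤ (p - 1) * e := by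
      exact_mod_cast h1
    exact Nat.le_of_mul_le_mul_left h3 hp1
  · intro hn
    -- The extremal coset sends `z` to `z ^ (p ^ n + 1) = z η`. Coprimality needs `n ≠ 0`: for `p =
    -- 2` and `n = 0` there is no nontrivial coset.
    have hcop : (p ^ n + 1).Coprime (p ^ (n + 1)) := by
      refine Nat.Coprime.pow_right _ ?_
      rw [Nat.coprime_comm, Nat.Prime.coprime_iff_not_dvd hp.out,
        Nat.dvd_add_right (dvd_pow_self p hn)]
      exact hp.out.one_lt.ne' ∘ Nat.dvd_one.mp
    obtain ⟨g₀, hg₀⟩ := exists_smul_eq_of_isPrimitiveRoot (K₀ := K₀) hζ hpA hz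
      (hzprim.pow_of_coprime _ hcop)
    have hsub : z - g₀ • z = -(z * (z ^ p ^ n - 1)) := by
      rw [hg₀]; ring
    have hne : g₀ • z ≠ z := by
      intro h
      rw [h, sub_self, eq_comm, neg_eq_zero] at hsub
      exact mul_ne_zero hzu.ne_zero hη1 hsub
    refine ⟨g₀, hne, ?_⟩
    have h1 := sum_displacement_eq hζ hpA hx hz hne
    rw [hsub, AddValuation.map_neg, addVal_mul, addVal_eq_zero_iff.mpr hzu, zero_add, ← he] at h1
    exact_mod_cast h1.ge

end CyclotomicSubextension

/-! ### Witt vectors and the comparison of conductors -/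

open IsDiscreteValuationRing

theorem isAlgClosed_residueField_wittVector (p : ℕ) [Fact p.Prime] (k : Type*) [Field k]
    [CharP k p] [IsAlgClosed k] : IsAlgClosed (IsLocalRing.ResidueField (WittVector p k)) := by
  have hsurj : Function.Surjective (WittVector.constantCoeff : WittVector p k →+* k) :=
    fun a => ⟨WittVector.teichmuller p a, WittVector.teichmuller_coeff_zero p a⟩
  have hker : RingHom.ker (WittVector.constantCoeff : WittVector p k →+* k) =
      IsLocalRing.maximalIdeal (WittVector p k) :=
    IsLocalRing.eq_maximalIdeal (RingHom.ker_isMaximal_of_surjective _ hsurj)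
  exact IsAlgClosed.of_ringEquiv k _
    ((Ideal.quotEquivOfEq hker.symm).trans
      (RingHom.quotientKerEquivOfSurjective hsurj)).symm

/-- A prime characteristic would also vanish in `k`, hence equal `p`; but `p` is irreducible in the
Witt vectors and so nonzero. -/
theorem charZero_of_isFractionRing_wittVector (p : ℕ) [Fact p.Prime] (k : Type*) [Field k]
    [CharP k p] [PerfectRing k p] (K₀ : Type*) [Field K₀] [Algebra (WittVector p k) K₀]
    [IsFractionRing (WittVector p k) K₀] : CharZero K₀ := by
  suffices CharZero (WittVector p k) from
    charZero_of_injective_algebraMap (IsFractionRing.injective (WittVector p k) K₀)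
  obtain ⟨q, hq⟩ := CharP.exists (WittVector p k)
  rcases CharP.char_is_prime_or_zero (WittVector p k) q with hprime | rfl
  · have h : ((q : ℕ) : k) = 0 := by
      rw [← map_natCast (WittVector.constantCoeff : WittVector p k →+* k), CharP.cast_eq_zero,
        map_zero]
    have hpq := (Nat.prime_dvd_prime_iff_eq Fact.out hprime).mp ((CharP.cast_eq_zero_iff k p q).mp h)
    subst hpq
    have hirr : Irreducible (p : WittVector p k) := WittVector.irreducible p
    exact absurd (CharP.cast_eq_zero (WittVector p k) p) hirr.ne_zero
  · exact CharP.charP_to_charZero _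

/-- The conductor of `M` over `K₀` in terms of that over the `p ^ (n + 1)`-th cyclotomic
subextension `L`, for an absolutely unramified base with algebraically closed residue field. -/
theorem conductor_eq_max {A K₀ L M : Type*} [CommRing A] [IsDomain A] [IsDiscreteValuationRing A]
    [IsAdicComplete (IsLocalRing.maximalIdeal A) A] [IsAlgClosed (IsLocalRing.ResidueField A)]
    [Field K₀] [CharZero K₀] [Algebra A K₀] [IsFractionRing A K₀]
    [Field L] [Algebra K₀ L] [Field M] [Algebra K₀ M] [Algebra L M] [IsScalarTower K₀ L M]
    [Algebra A M] [IsScalarTower A K₀ M] [FiniteDimensional K₀ M] [IsGalois K₀ M]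
    {p : ℕ} [hp : Fact p.Prime] {n : ℕ} [IsCyclotomicExtension {p ^ (n + 1)} K₀ L]
    (hpA : Irreducible (p : A)) :
    conductor A K₀ K₀ M = max (n : ℝ) ((n + 1 : ℝ) - p / (p - 1) +
      1 / ((p - 1) * p ^ n) * (conductor A K₀ L M + 1)) := by
  classical
  have := isDiscreteValuationRing_integralClosure A K₀ M
  have := FiniteDimensional.right K₀ L M
  have := FiniteDimensional.left K₀ L M
  have := IsGalois.tower_top_of_isGalois K₀ L M
  have hppos : 0 < p ^ (n + 1) := pow_pos hp.out.pos _
  have : NeZero (p ^ (n + 1)) := ⟨hppos.ne'⟩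
  let _ : Algebra A L := ((algebraMap K₀ L).comp (algebraMap A K₀)).toAlgebra
  have : IsScalarTower A K₀ L := IsScalarTower.of_algebraMap_eq fun _ => rfl
  obtain ⟨ζ, hζ⟩ : ∃ ζ : L, IsPrimitiveRoot ζ (p ^ (n + 1)) :=
    ⟨_, IsCyclotomicExtension.zeta_spec (p ^ (n + 1)) K₀ L⟩
  obtain ⟨z, hz⟩ : ∃ z : integralClosure A M, (z : M) = algebraMap L M ζ :=
    ⟨⟨algebraMap L M ζ,
      (hζ.map_of_injective (algebraMap L M).injective).isIntegral hppos |>.tower_top⟩, rfl⟩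
  obtain ⟨x, hirr⟩ := exists_irreducible (integralClosure A M)
  have hx : Algebra.adjoin A {x} = ⊤ := adjoin_uniformizer_integralClosure_eq_top K₀ hirr
  set i : (M ≃ₐ[K₀] M) → ℕ := displacement x
  let ρ : (M ≃ₐ[L] M) →* (M ≃ₐ[K₀] M) := AlgEquiv.restrictScalarsHom K₀
  have hρ : Function.Injective ρ := AlgEquiv.restrictScalarsHom_injective K₀
  have hpos : ∀ g : M ≃ₐ[K₀] M, g ≠ 1 → 1 ≤ i g := fun g hg => one_le_displacement hx hirr hg
  have hposL : ∀ h : M ≃ₐ[L] M, h ≠ 1 → 1 ≤ i (ρ h) := fun h hh =>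
    hpos _ ((map_ne_one_iff ρ hρ).mpr hh)
  have hc : ∀ g g' : M ≃ₐ[K₀] M, g' • z = g • z ↔ ∃ h, g' = g * ρ h := by
    intro g g'
    constructor
    · intro h
      have h1 : (g⁻¹ * g') • z = z := by rw [mul_smul, h, inv_smul_smul]
      obtain ⟨s, hs⟩ := exists_restrictScalars_eq hζ (g := g⁻¹ * g') (by
        rw [← hz]; exact congrArg Subtype.val h1)
      exact ⟨s, by rw [show ρ s = g⁻¹ * g' from hs, mul_inv_cancel_left]⟩
    · rintro ⟨s, rfl⟩
      have : ρ s • z = z := Subtype.ext (by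
        change s z = z
        rw [hz, s.commutes])
      rw [mul_smul, this]
  obtain ⟨mG, hmG⟩ := exists_isLastJump hpos
  obtain ⟨mH, hmH⟩ := exists_isLastJump hposL
  obtain ⟨e, he, hsum, hub, hlb⟩ := exists_sum_displacement (K₀ := K₀) hζ hpA hx hz
  have hmax := lastJump_add_sum_eq_max hρ hc hpos
    (fun g h hg hh hgh => min_displacement_le hx (hpos g hg) (hpos h hh) hgh)
    (displacement_inv hx hpos) hmG hmH hub (by
      by_cases hn : n = 0
      · left
        rw [hn] at hsum
        simpa using hsum
      · exact Or.inr (hlb hn))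
  have hsplit := sum_erase_one_eq hρ hc (i := i)
  have hcondG := conductor_eq (A := A) (K₀ := K₀) (K := K₀) hpos
    (fun t ht g => mem_lowerRamificationGroup_iff_displacement hx ht g) hmG.1 hmG.2
  have hcondH := conductor_eq (A := A) (K₀ := K₀) (K := L) hposL
    (fun t ht g => mem_lowerRamificationGroup_iff_displacement hx ht g) hmH.1 hmH.2
  have hcard : Fintype.card (M ≃ₐ[K₀] M) =
      p ^ n * (p - 1) * Fintype.card (M ≃ₐ[L] M) := by
    rw [← Nat.card_eq_fintype_card, ← Nat.card_eq_fintype_card, IsGalois.card_aut_eq_finrank,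
      IsGalois.card_aut_eq_finrank, ← Module.finrank_mul_finrank K₀ L M,
      (finrank_eq_totient (A := A) (K₀ := K₀) hpA hζ).1, Nat.totient_prime_pow_succ hp.out]
  rw [hcondG, hcondH, ← Nat.cast_sum, ← Nat.cast_sum, hsplit]
  set T := ∑ h ∈ Finset.univ.erase (1 : M ≃ₐ[L] M), i (ρ h)
  set R := ∑ g : M ≃ₐ[K₀] M with g • z ≠ (1 : M ≃ₐ[K₀] M) • z, i g
  have hNH : (0 : ℝ) < Fintype.card (M ≃ₐ[L] M) := by exact_mod_cast Fintype.card_pos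
  have hp1 : (0 : ℝ) < p - 1 := by
    rw [sub_pos]; exact_mod_cast hp.out.one_lt
  have hp0 : (0 : ℝ) < p := by exact_mod_cast hp.out.pos
  have hsub : ((p - 1 : ℕ) : ℝ) = p - 1 := Nat.cast_pred hp.out.pos
  have hcardR : (Fintype.card (M ≃ₐ[K₀] M) : ℝ) =
      p ^ n * (p - 1) * Fintype.card (M ≃ₐ[L] M) := by
    rw [hcard]; push_cast [hsub]; ring
  have heR : (p - 1) * (e : ℝ) = Fintype.card (M ≃ₐ[K₀] M) := by
    rw [← he]; push_cast [hsub]; ring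
  have hsumR : (R : ℝ) + e = (n + 1) * Fintype.card (M ≃ₐ[K₀] M) := by exact_mod_cast hsum
  have hmaxR : (mG : ℝ) + 1 + T = max (e : ℝ) (mH + 1 + T) := by exact_mod_cast hmax
  have hN : (0 : ℝ) < Fintype.card (M ≃ₐ[K₀] M) := by exact_mod_cast Fintype.card_pos
  have hpow : (0 : ℝ) < (p : ℝ) ^ n := by positivity
  rw [hcardR] at heR hsumR hN ⊢
  set H : ℝ := (Fintype.card (M ≃ₐ[L] M) : ℝ)
  have heq : (e : ℝ) = p ^ n * H := by
    apply mul_left_cancel₀ hp1.ne'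
    rw [heR]; ring
  have hR : (R : ℝ) = (n + 1) * (p ^ n * (p - 1) * H) - p ^ n * H := by
    rw [← hsumR, heq]; ring
  rw [heq] at hmaxR
  -- The different contributes the constant `R/|G| - 1 = (n + 1) - p/(p - 1)`. Taking `y = e` gives
  -- `n`, and `y = mH + 1 + T` gives the second entry of the maximum.
  have hshift : ∀ y : ℝ, (y + R) / (p ^ n * (p - 1) * H) - 1 =
      (n + 1 : ℝ) - p / (p - 1) + y / (p ^ n * (p - 1) * H) := by
    intro y
    rw [hR]
    field_simp
    ring
  have hfirst : (n : ℝ) = (n + 1 : ℝ) - p / (p - 1) + (p ^ n * H) / (p ^ n * (p - 1) * H) := by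
    field_simp
    ring
  have hsecond : 1 / (((p : ℝ) - 1) * p ^ n) * ((mH + 1 + T) / H - 1 + 1) =
      (mH + 1 + T) / (p ^ n * (p - 1) * H) := by
    field_simp
    ring
  rw [hsecond]
  refine Eq.trans ?_ (congrArg (max · _) hfirst.symm)
  rw [max_add_add_left, max_div_div_right hN.le, ← hmaxR, ← hshift]
  push_cast
  ring

end LocalRamification

/-- Let `k` be an algebraically closed field of characteristic `p > 0`, `K₀ = Frac W(k)`, `ℓ ≥ 1`,
`Kl = K₀(ζ_{p^ℓ})`, and `M/Kl` a finite extension such that `M/K₀` is Galois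
(as `Kl/K₀` is finite, it is the same to ask that `M/K₀` be finite). -/
theorem corollary2p4 (p : ℕ) [Fact p.Prime] (k : Type*) [Field k] [CharP k p] [IsAlgClosed k]
    (K₀ : Type*) [Field K₀] [Algebra (WittVector p k) K₀] [IsFractionRing (WittVector p k) K₀]
    (l : ℕ) (hl : 1 ≤ l)
    (Kl : Type*) [Field Kl] [Algebra K₀ Kl] [IsCyclotomicExtension {p ^ l} K₀ Kl]
    (M : Type*) [Field M] [Algebra K₀ M] [Algebra Kl M] [IsScalarTower K₀ Kl M]
    [Algebra (WittVector p k) M] [IsScalarTower (WittVector p k) K₀ M]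
    [FiniteDimensional K₀ M] [IsGalois K₀ M] :
    LocalRamification.conductor (WittVector p k) K₀ K₀ M =
      max ((l : ℝ) - 1)
        ((l : ℝ) - (p : ℝ) / ((p : ℝ) - 1) +
          1 / (((p : ℝ) - 1) * (p : ℝ) ^ (l - 1)) *
            (LocalRamification.conductor (WittVector p k) K₀ Kl M + 1)) := by
  obtain ⟨n, rfl⟩ := Nat.exists_eq_add_of_le' hl
  have := LocalRamification.isAlgClosed_residueField_wittVector p k
  have := LocalRamification.charZero_of_isFractionRing_wittVector p k K₀
  rw [LocalRamification.conductor_eq_max (L := Kl) (n := n) (WittVector.irreducible p)]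
  push_cast
  simp only [add_sub_cancel_right]
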